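/- **Setting.** A (countable) MDP $\mathcal M$ consists of a countable set $S$ of states, partitioned into controlled and random states, a transition relation $\longrightarrow\subseteq S\times S$ such that every state has at least one successor, a probability distribution $P(s)$ over the successors of $s$ for every random state $s$, and real transition rewards $r:S\times S\to\mathbb R$. It is finitely branching if every state has finitely many successors, and acyclic if the graph $(S,\longrightarrow)$ has no directed cycle. A run from $s_0$ is an infinite sequence $s_0s_1s_2\cdots$ with $s_i\longrightarrow s_{i+1}$ for all $i$; a partial run is a finite prefix of a run. The total reward is implicit in the state (with respect to the initial state $s_0$) if for every state $s$ all partial runs from $s_0$ to $s$ have the same total reward $\sum_j r(s_j,s_{j+1})$. A strategy $\sigma$ assigns to every partial run ending in a controlled state $s$ a probability distribution over the successors of $s$; it may depend on the whole history. It is deterministic if all these distributions are Dirac. An initial state $s_0$ and a strategy $\sigma$ induce in the usual way a probability measure $\mathcal P_{\mathcal M,s_0,\sigma}$ on the runs from $s_0$. A strategy is a finite-memory randomized (FR) strategy if it is induced by a finite set $\mathsf M$ of memory modes, an initial mode $\mathsf m_0\in\mathsf M$ and a function $\tau$ that maps each $(\mathsf m,s)\in\mathsf M\times S$ to a probability distribution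 on $\mathsf M\times S$, such that $\tau(\mathsf m,s)$ is supported on $\mathsf M\times\{s' : s\longrightarrow s'\}$ if $s$ is controlled, and $\sum_{\mathsf m'}\tau(\mathsf m,s)(\mathsf m',s')=P(s)(s')$ for all $s'$ if $s$ is random. Here "induced" means that $$\sigma(s_0\cdots s_n)(s')=\sum_{\mathsf m,\mathsf m'\in\mathsf M}\mu(\mathsf m)\,\tau(\mathsf m,s_n)(\mathsf m',s')$$ whenever $s_n$ is controlled and the Markov chain on $\mathsf M\times S$ with transition function $\tau$, started in $(\mathsf m_0,s_0)$, follows the states $s_0,\dots,s_n$ with positive probability, where $\mu$ is the distribution of the mode after $n$ steps conditioned on this event. Let $$\mathit{MP}_{\liminf\ge 0}=\Big\{s_0s_1\cdots \;:\; \liminf_{n\to\infty}\frac1n\sum_{j=0}^{n-1}r(s_j,s_{j+1})\ge 0\Big\}.$$ **Theorem.** There exist a countable, finitely branching and acyclic MDP $\mathcal M_{\text{Restart}}$ and an initial state $s_0$, with the total reward implicit in the state, such that - there is a history-dependent deterministic strategy $\sigma$ with $\mathcal P_{\mathcal M_{\text{Restart}},s_0,\sigma}(\mathit{MP}_{\liminf\ge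 0})=1$; - every finite-memory randomized strategy $\sigma$ satisfies $\mathcal P_{\mathcal M_{\text{Restart}},s_0,\sigma}(\mathit{MP}_{\liminf\ge 0})=0$. -/

import Mathlib

open MeasureTheory ProbabilityTheory Filter

noncomputable section

/-- A countable Markov decision process with real transition rewards. The random states are the
states that are not controlled. -/
structure MDP where
  State : Type
  countable_state : Countable State
  controlled : Set State
  /-- The transition relation. -/
  step : State → State → Prop
  exists_step : ∀ s, ∃ s', step s s'
  /-- The probability function on the random states. -/
  prob : ∀ s, s ∉ controlled → PMF State
  prob_support : ∀ s (hs : s ∉ controlled), ∀ s' ∈ (prob s hs).support, step s s'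
  reward : State → State → ℝ

namespace MDP

instance (M : MDP) : Countable M.State := M.countable_state

/-- The state space is discrete, so that `ℕ → M.State` carries the σ-algebra generated by the
cylinders. -/
instance (M : MDP) : MeasurableSpace M.State := ⊤

instance (M : MDP) : DiscreteMeasurableSpace M.State := ⟨fun _ => trivial⟩

def FinitelyBranching (M : MDP) : Prop := ∀ s, {s' | M.step s s'}.Finite

/-- There is no directed cycle of positive length. -/
def Acyclic (M : MDP) : Prop := ∀ s, ¬ Relation.TransGen M.step s s

/-- The runs from `s₀`, each given by its sequence of states. -/
def runs (M : MDP) (s₀ : M.State) : Set (ℕ → M.State) :=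
  {ρ | ρ 0 = s₀ ∧ ∀ i, M.step (ρ i) (ρ (i + 1))}

/-- The sum of the rewards of the first `n` transitions. -/
def totalReward (M : MDP) (ρ : ℕ → M.State) (n : ℕ) : ℝ :=
  ∑ j ∈ Finset.range n, M.reward (ρ j) (ρ (j + 1))

/-- The total reward is implicit in the state: for every state `s` there is one value that is the
total reward of all the partial runs from `s₀` to `s`. (As every state has a successor, every
finite path is a prefix of a run.) -/
def TotalRewardImplicit (M : MDP) (s₀ : M.State) : Prop :=
  ∀ s, ∃ R : ℝ, ∀ ρ ∈ M.runs s₀, ∀ n, ρ n = s → M.totalReward ρ n = R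

/-- The runs from `s₀` whose mean payoff has limit inferior at least `0`, the limit inferior being
taken in the extended reals. -/
def meanPayoffLiminfNonneg (M : MDP) (s₀ : M.State) : Set (ℕ → M.State) :=
  {ρ | ρ ∈ M.runs s₀ ∧
    (0 : EReal) ≤ liminf (fun n : ℕ => ((1 / (n : ℝ) * M.totalReward ρ n : ℝ) : EReal)) atTop}

/-- Sequences `s_0 … s_n` of states. -/
abbrev Hist (M : MDP) (n : ℕ) : Type := (i : Finset.Iic n) → (fun _ : ℕ => M.State) i

/-- The last state `s_n` of the sequence `s_0 … s_n`. -/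
def last (M : MDP) {n : ℕ} (h : M.Hist n) : M.State := h ⟨n, Finset.mem_Iic.2 le_rfl⟩

/-- The sequence `s_0 … s_n` without its last state. -/
def initial (M : MDP) {n : ℕ} (h : M.Hist (n + 1)) : M.Hist n :=
  Preorder.frestrictLe₂ (π := fun _ : ℕ => M.State) n.le_succ h

/-- A general (history dependent, randomized) strategy: it assigns to every finite sequence of
states that ends in a controlled state a distribution over the successors of that state. Values at
sequences that are not partial runs are irrelevant. -/
structure Strategy (M : MDP) where
  act : ∀ (n : ℕ) (h : M.Hist n), M.last h ∈ M.controlled → PMF M.State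
  act_support : ∀ n h hc, ∀ s' ∈ (act n h hc).support, M.step (M.last h) s'

/-- A deterministic (history dependent) strategy: all its values are Dirac distributions. -/
def Strategy.IsDeterministic {M : MDP} (σ : M.Strategy) : Prop :=
  ∀ n h hc, ∃ s', σ.act n h hc = PMF.pure s'

open Classical in
/-- The extension of a strategy by the probability function at the random states. -/
def Strategy.ext {M : MDP} (σ : M.Strategy) (n : ℕ) (h : M.Hist n) : PMF M.State :=
  if hc : M.last h ∈ M.controlled then σ.act n h hc else M.prob (M.last h) hc

/-- The transition kernel from the sequences `s_0 … s_n` to the next state. -/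
def Strategy.kernel {M : MDP} (σ : M.Strategy) (n : ℕ) :
    Kernel (M.Hist n) ((fun _ : ℕ => M.State) (n + 1)) :=
  Kernel.ofFunOfCountable fun h => (σ.ext n h).toMeasure

instance {M : MDP} (σ : M.Strategy) (n : ℕ) : IsMarkovKernel (σ.kernel n) :=
  ⟨fun h => inferInstanceAs (IsProbabilityMeasure (σ.ext n h).toMeasure)⟩

/-- The probability measure on the sequences of states that is induced by the initial state `s₀`
and the strategy `σ`. -/
def runMeasure (M : MDP) (s₀ : M.State) (σ : M.Strategy) : Measure (ℕ → M.State) :=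
  Kernel.traj (X := fun _ : ℕ => M.State) σ.kernel 0 (fun _ => s₀)

/-- A randomized memory update `τ` with the set `Mode` of memory modes, and an initial mode. -/
structure Memory (M : MDP) (Mode : Type) where
  init : Mode
  update : Mode → M.State → PMF (Mode × M.State)
  update_controlled : ∀ m s, s ∈ M.controlled → ∀ p ∈ (update m s).support, M.step s p.2
  update_random : ∀ m s (hs : s ∉ M.controlled) s',
    ∑' m', update m s (m', s') = M.prob s hs s'

/-- The probability that the Markov chain on `Mode × M.State` with transition probabilities
`update`, started in the initial mode and the state `s_0`, follows in its first `n` steps the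
states `s_0 … s_n` and is then in the mode `m`. -/
def Memory.weight {M : MDP} {Mode : Type} (T : M.Memory Mode) :
    (n : ℕ) → M.Hist n → Mode → ENNReal
  | 0, _, m => PMF.pure T.init m
  | n + 1, h, m =>
      ∑' m', T.weight n (M.initial h) m' * T.update m' (M.last (M.initial h)) (m, M.last h)

/-- The distribution of the mode, conditioned on having followed the states `s_0 … s_n`. It is
meaningful if this has positive probability. -/
def Memory.condMode {M : MDP} {Mode : Type} (T : M.Memory Mode) (n : ℕ) (h : M.Hist n)
    (m : Mode) : ENNReal :=
  T.weight n h m / ∑' m', T.weight n h m'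

/-- `σ` is the strategy induced by the memory `T`. Where the conditional distribution of the mode
is undefined (at sequences of probability `0`), `σ` may take any value. -/
def Memory.Implements {M : MDP} {Mode : Type} (T : M.Memory Mode) (σ : M.Strategy) : Prop :=
  ∀ n h (hc : M.last h ∈ M.controlled), ∑' m, T.weight n h m ≠ 0 →
    ∀ s', σ.act n h hc s' = ∑' m, ∑' m', T.condMode n h m * T.update m (M.last h) (m', s')

/-- A finite memory (randomized) strategy. -/
def Strategy.IsFiniteMemory {M : MDP} (σ : M.Strategy) : Prop :=
  ∃ (Mode : Type) (_ : Finite Mode) (T : M.Memory Mode), T.Implements σ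

end MDP

end

/-! The process is a chain of gadgets. In a gadget with top level k a level i is drawn with weight
2^{-k(k-i)}, the run waits for a time growing steeply with i, and at a fork that has forgotten i a
level j is chosen. The choice costs a temporary loss that is negligible against the wait of level j
but exceeds the time elapsed after the wait of any lower level (`time_le_loss`). It is followed by a
crash with probability 2^{-k(j+1)}, whose loss is ruinous at any time in the gadget. There are
(k+1)2^{k²} gadgets with top level k.

A strategy that looks back and takes j = i makes the losses negligible. Each i contributes at most
2^{-k(k-i)}·2^{-k(i+1)} = 2^{-k(k+1)} to the crash probability; these bounds are summable over all
gadgets (`tsum_lev_crash_ne_top`), so almost surely only finitely many crashes occur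
(`runMeasure_delayStrategy`).

With K modes and k ≥ K, two levels i < i' lead to forks at which the same mode has conditional
probability at least 1/K. Whatever j that mode selects, either j ≥ i', which is too large after the
wait of level i, or j < i', where the crash after level i' is too likely. Either way a failure has
probability at least 2^{-k²}/((k+1)K), given any history up to the entry of the gadget
(`failureBound_mul_cyl_le`). The sum of these bounds diverges, so failures occur infinitely often
almost surely (`ae_exists_failure`), and each one pushes the mean payoff to -1 or below. -/

namespace MDP

/-! ### One-step formulas for the run measure of a general MDP. -/

variable {M : MDP}

instance (s₀ : M.State) (σ : M.Strategy) : IsProbabilityMeasure (M.runMeasure s₀ σ) := by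
  unfold runMeasure
  infer_instance

theorem frestrictLe_apply_eq_iff {t : ℕ} (ω ρ : ℕ → M.State) :
    (Preorder.frestrictLe t ω : M.Hist t) = Preorder.frestrictLe t ρ ↔ ∀ i ≤ t, ω i = ρ i := by
  constructor
  · intro h i hi
    exact congrFun h ⟨i, Finset.mem_Iic.2 hi⟩
  · intro h
    funext i
    exact h i (Finset.mem_Iic.1 i.2)

/-- The joint law of the history and the next state is the history marginal composed with the
kernel. All sets of histories are measurable because there are only countably many histories. -/
theorem runMeasure_step_eq_lintegral (s₀ : M.State) (σ : M.Strategy) (t : ℕ) (A : Set (M.Hist t))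
    (s : M.State) :
    M.runMeasure s₀ σ {ω | Preorder.frestrictLe t ω ∈ A ∧ ω (t + 1) = s} =
      ∫⁻ ω in {ω | Preorder.frestrictLe t ω ∈ A}, σ.ext t (Preorder.frestrictLe t ω) s
        ∂(M.runMeasure s₀ σ) := by
  have hA : MeasurableSet A := A.to_countable.measurableSet
  have hs : MeasurableSet ({s} : Set M.State) := trivial
  have hm : Measurable (fun ω : ℕ → M.State => (Preorder.frestrictLe t ω : M.Hist t)) :=
    Preorder.measurable_frestrictLe (X := fun _ : ℕ => M.State) t
  have hm' : Measurable (fun ω : ℕ → M.State =>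
      ((Preorder.frestrictLe t ω : M.Hist t), ω (t + 1))) := hm.prodMk (measurable_pi_apply _)
  have key := Kernel.partialTraj_compProd_eq_map_traj (X := fun _ : ℕ => M.State) (κ := σ.kernel)
    (a := 0) (b := t) (Nat.zero_le t) (x₀ := fun _ => s₀)
  have h1 : M.runMeasure s₀ σ {ω | Preorder.frestrictLe t ω ∈ A ∧ ω (t + 1) = s} =
      ((M.runMeasure s₀ σ).map fun ω => ((Preorder.frestrictLe t ω : M.Hist t), ω (t + 1)))
        (A ×ˢ {s}) := by
    rw [Measure.map_apply hm' (hA.prod hs)]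
    rfl
  have h2 : ∀ h : M.Hist t, σ.kernel t h ({s} : Set M.State) = σ.ext t h s := by
    intro h
    exact PMF.toMeasure_apply_singleton _ _ hs
  rw [h1]
  unfold runMeasure
  rw [← key, Measure.compProd_apply_prod hA hs, ← Kernel.traj_map_frestrictLe_apply,
    setLIntegral_map hA (Kernel.measurable_coe _ hs) hm]
  simp_rw [h2]
  rfl

theorem runMeasure_step_le (s₀ : M.State) (σ : M.Strategy) {t : ℕ} {A : Set (M.Hist t)}
    {s : M.State} {c : ENNReal} (hc : ∀ h ∈ A, σ.ext t h s ≤ c) :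
    M.runMeasure s₀ σ {ω | Preorder.frestrictLe t ω ∈ A ∧ ω (t + 1) = s} ≤
      c * M.runMeasure s₀ σ {ω | Preorder.frestrictLe t ω ∈ A} := by
  rw [runMeasure_step_eq_lintegral, ← setLIntegral_const]
  have hA : MeasurableSet A := A.to_countable.measurableSet
  refine setLIntegral_mono' (Preorder.measurable_frestrictLe (X := fun _ : ℕ => M.State) t hA) ?_
  intro ω hω
  exact hc _ hω

/-- The sequences of states that agree with `ρ` up to time `t`. -/
def cyl (ρ : ℕ → M.State) (t : ℕ) : Set (ℕ → M.State) := {ω | ∀ i ≤ t, ω i = ρ i}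

theorem cyl_eq_frestrictLe (ρ : ℕ → M.State) (t : ℕ) :
    cyl ρ t = {ω | (Preorder.frestrictLe t ω : M.Hist t) ∈
      ({(Preorder.frestrictLe t ρ : M.Hist t)} : Set (M.Hist t))} := by
  ext ω
  exact (frestrictLe_apply_eq_iff ω ρ).symm

theorem measurableSet_cyl (ρ : ℕ → M.State) (t : ℕ) : MeasurableSet (cyl ρ t) := by
  rw [cyl_eq_frestrictLe]
  exact Preorder.measurable_frestrictLe (X := fun _ : ℕ => M.State) t
    (Set.to_countable _).measurableSet

theorem cyl_succ (ρ : ℕ → M.State) (t : ℕ) :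
    cyl ρ (t + 1) = cyl ρ t ∩ {ω | ω (t + 1) = ρ (t + 1)} := by
  ext ω
  constructor
  · intro h
    exact ⟨fun i hi => h i (by omega), h _ le_rfl⟩
  · rintro ⟨h, h'⟩ i hi
    rcases Nat.lt_or_ge t i with h1 | h1
    · obtain rfl : i = t + 1 := by omega
      exact h'
    · exact h i h1

theorem cyl_congr {ρ ρ' : ℕ → M.State} {t : ℕ} (h : ∀ i ≤ t, ρ i = ρ' i) : cyl ρ t = cyl ρ' t := by
  ext ω
  exact forall₂_congr fun i hi => by rw [h i hi]

theorem runMeasure_cyl_succ (s₀ : M.State) (σ : M.Strategy) (ρ : ℕ → M.State) (t : ℕ) :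
    M.runMeasure s₀ σ (cyl ρ (t + 1)) =
      M.runMeasure s₀ σ (cyl ρ t) * σ.ext t (Preorder.frestrictLe t ρ) (ρ (t + 1)) := by
  have h1 := runMeasure_step_eq_lintegral s₀ σ t {(Preorder.frestrictLe t ρ : M.Hist t)} (ρ (t + 1))
  have h2 : cyl ρ (t + 1) = {ω | (Preorder.frestrictLe t ω : M.Hist t) ∈
      ({(Preorder.frestrictLe t ρ : M.Hist t)} : Set (M.Hist t)) ∧ ω (t + 1) = ρ (t + 1)} := by
    rw [cyl_succ, cyl_eq_frestrictLe]
    rfl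
  rw [h2, h1, ← cyl_eq_frestrictLe]
  have h3 : ∫⁻ ω in cyl ρ t, σ.ext t (Preorder.frestrictLe t ω) (ρ (t + 1)) ∂(M.runMeasure s₀ σ) =
      ∫⁻ ω in cyl ρ t, σ.ext t (Preorder.frestrictLe t ρ) (ρ (t + 1)) ∂(M.runMeasure s₀ σ) := by
    refine setLIntegral_congr_fun (measurableSet_cyl ρ t) ?_
    intro ω hω
    have : (Preorder.frestrictLe t ω : M.Hist t) = Preorder.frestrictLe t ρ :=
      (frestrictLe_apply_eq_iff ω ρ).2 hω
    simp only [this]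
  rw [h3, setLIntegral_const, mul_comm]

theorem runMeasure_cyl_inter (s₀ : M.State) (σ : M.Strategy) (ρ : ℕ → M.State) (t : ℕ)
    (s : M.State) :
    M.runMeasure s₀ σ (cyl ρ t ∩ {ω | ω (t + 1) = s}) =
      M.runMeasure s₀ σ (cyl ρ t) * σ.ext t (Preorder.frestrictLe t ρ) s := by
  classical
  have h := runMeasure_cyl_succ s₀ σ (Function.update ρ (t + 1) s) t
  have h1 : ∀ i ≤ t, Function.update ρ (t + 1) s i = ρ i := fun i hi =>
    Function.update_of_ne (by omega) _ _
  rwa [cyl_succ, cyl_congr h1, (frestrictLe_apply_eq_iff _ _).2 h1, Function.update_self] at h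

theorem ae_zero (s₀ : M.State) (σ : M.Strategy) : ∀ᵐ ω ∂M.runMeasure s₀ σ, ω 0 = s₀ := by
  have key : (M.runMeasure s₀ σ).map (fun ω => (Preorder.frestrictLe 0 ω : M.Hist 0)) =
      Measure.dirac (fun _ => s₀) := by
    unfold runMeasure
    have := Kernel.traj_map_frestrictLe_apply (X := fun _ : ℕ => M.State) (κ := σ.kernel) 0 0
      (fun _ => s₀)
    rw [Kernel.partialTraj_self, Kernel.id_apply] at this
    exact this
  have hm : Measurable (fun ω : ℕ → M.State => (Preorder.frestrictLe 0 ω : M.Hist 0)) :=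
    Preorder.measurable_frestrictLe (X := fun _ : ℕ => M.State) 0
  have h1 : ∀ᵐ h ∂(M.runMeasure s₀ σ).map
      (fun ω => (Preorder.frestrictLe 0 ω : M.Hist 0)), M.last h = s₀ := by
    rw [key, ae_dirac_iff (Set.to_countable _).measurableSet]
    rfl
  exact ae_of_ae_map hm.aemeasurable h1

/-- Each pair of a time and a next state gives a null event, and there are countably many pairs. For
Dirac choices this says that the run almost surely obeys them. -/
theorem ae_ext_ne_zero (s₀ : M.State) (σ : M.Strategy) :
    ∀ᵐ ω ∂M.runMeasure s₀ σ, ∀ t, σ.ext t (Preorder.frestrictLe t ω) (ω (t + 1)) ≠ 0 := by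
  rw [ae_all_iff]
  intro t
  have h1 : ∀ s : M.State, ∀ᵐ ω ∂M.runMeasure s₀ σ,
      ¬ ((Preorder.frestrictLe t ω : M.Hist t) ∈ {h : M.Hist t | σ.ext t h s = 0} ∧ ω (t + 1) = s) := by
    intro s
    have := runMeasure_step_le s₀ σ (t := t) (A := {h : M.Hist t | σ.ext t h s = 0}) (s := s)
      (c := 0) (fun h hh => le_of_eq hh)
    rw [zero_mul] at this
    rw [ae_iff]
    simpa only [not_not] using nonpos_iff_eq_zero.1 this
  filter_upwards [ae_all_iff.2 h1] with ω hω h0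
  exact hω (ω (t + 1)) ⟨h0, rfl⟩

theorem Strategy.step_of_ext_ne_zero (σ : M.Strategy) {t : ℕ} {h : M.Hist t} {s : M.State}
    (hs : σ.ext t h s ≠ 0) : M.step (M.last h) s := by
  unfold Strategy.ext at hs
  split_ifs at hs with hc
  · exact σ.act_support t h hc s ((PMF.mem_support_iff _ _).2 hs)
  · exact M.prob_support _ hc s ((PMF.mem_support_iff _ _).2 hs)

theorem ae_mem_runs (s₀ : M.State) (σ : M.Strategy) :
    ∀ᵐ ω ∂M.runMeasure s₀ σ, ω ∈ M.runs s₀ := by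
  filter_upwards [ae_zero s₀ σ, ae_ext_ne_zero s₀ σ] with ω h0 h1
  exact ⟨h0, fun t => σ.step_of_ext_ne_zero (h1 t)⟩

theorem exists_run_mem_cyl {s₀ : M.State} {σ : M.Strategy} {ρ : ℕ → M.State} {t : ℕ}
    (h : M.runMeasure s₀ σ (cyl ρ t) ≠ 0) : ∃ ω ∈ M.runs s₀, ω ∈ cyl ρ t := by
  by_contra! hne
  refine h (measure_mono_null (t := (M.runs s₀)ᶜ) (fun ω hω hr => hne ω hr hω) ?_)
  exact ae_mem_runs s₀ σ

theorem Strategy.ext_of_mem (σ : M.Strategy) {t : ℕ} {h : M.Hist t} (hc : M.last h ∈ M.controlled) :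
    σ.ext t h = σ.act t h hc := dif_pos hc

theorem Strategy.ext_of_notMem (σ : M.Strategy) {t : ℕ} {h : M.Hist t}
    (hc : M.last h ∉ M.controlled) : σ.ext t h = M.prob (M.last h) hc := dif_neg hc

/-! ### Acyclic runs and expected numbers of visits. -/

theorem transGen_run {s₀ : M.State} {ω : ℕ → M.State} (hω : ω ∈ M.runs s₀) {t u : ℕ}
    (h : t < u) : Relation.TransGen M.step (ω t) (ω u) := by
  induction u, h using Nat.le_induction with
  | base => exact .single (hω.2 t)
  | succ u _ ih => exact ih.tail (hω.2 u)

theorem Acyclic.run_injective (hM : M.Acyclic) {s₀ : M.State} {ω : ℕ → M.State}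
    (hω : ω ∈ M.runs s₀) : Function.Injective ω := by
  intro t u h
  by_contra hne
  rcases Nat.lt_or_gt_of_ne hne with h1 | h1
  · have := transGen_run hω h1
    rw [h] at this
    exact hM _ this
  · have := transGen_run hω h1
    rw [h] at this
    exact hM _ this

/-- The expected number of visits of a state. -/
noncomputable def visits (s₀ : M.State) (σ : M.Strategy) (s : M.State) : ENNReal :=
  ∑' t, M.runMeasure s₀ σ {ω | ω t = s}

theorem measurableSet_eval_eq (t : ℕ) (s : M.State) :
    MeasurableSet {ω : ℕ → M.State | ω t = s} :=
  measurable_pi_apply (X := fun _ : ℕ => M.State) t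
    (MeasurableSet.of_discrete (s := ({s} : Set M.State)))

/-- Acyclicity makes the events of being in `s` at different times almost disjoint. -/
theorem Acyclic.visits_le_one (hM : M.Acyclic) (s₀ : M.State) (σ : M.Strategy) (s : M.State) :
    visits s₀ σ s ≤ 1 := by
  unfold visits
  rw [← measure_univ (μ := M.runMeasure s₀ σ)]
  refine tsum_measure_le_measure_univ (fun t => (measurableSet_eval_eq t s).nullMeasurableSet) ?_
  intro t u htu
  refine measure_mono_null (t := (M.runs s₀)ᶜ) ?_ (ae_mem_runs s₀ σ)
  intro ω h hω
  exact htu (hM.run_injective hω ((h.1 : ω t = s).trans (h.2 : ω u = s).symm))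

theorem visits_le_of_ae_pred {s₀ : M.State} {σ : M.Strategy} {x y : M.State} (d : ℕ)
    (h : ∀ᵐ ω ∂M.runMeasure s₀ σ, (∀ t < d, ω t ≠ y) ∧ ∀ t, ω (t + d) = y → ω t = x) :
    visits s₀ σ y ≤ visits s₀ σ x := by
  unfold visits
  rw [← Summable.sum_add_tsum_nat_add' (k := d) ENNReal.summable, Finset.sum_eq_zero, zero_add]
  · refine ENNReal.tsum_le_tsum fun t => measure_mono_ae ?_
    filter_upwards [h] with ω hω hy
    exact hω.2 t hy
  · intro t ht
    refine measure_mono_null ?_ h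
    intro ω hy hω
    exact hω.1 t (Finset.mem_range.1 ht) hy

/-- A union bound over the possible random predecessors. Working with visit counts makes it
unnecessary to know when a state is reached. -/
theorem visits_le_of_ae_pred_mem {s₀ : M.State} {σ : M.Strategy} {y : M.State} {ι : Type*}
    (F : Finset ι) (f : ι → M.State) (c : ι → ENNReal)
    (hf : ∀ i ∈ F, ∃ hc : f i ∉ M.controlled, M.prob (f i) hc y ≤ c i) (hy : y ≠ s₀)
    (h : ∀ᵐ ω ∂M.runMeasure s₀ σ, ∀ t, ω (t + 1) = y → ∃ i ∈ F, ω t = f i) :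
    visits s₀ σ y ≤ ∑ i ∈ F, c i * visits s₀ σ (f i) := by
  have h0 : M.runMeasure s₀ σ {ω | ω 0 = y} = 0 := by
    refine measure_mono_null ?_ (ae_zero s₀ σ)
    intro ω h' hω
    exact hy ((h' : ω 0 = y).symm.trans hω)
  unfold visits
  rw [tsum_eq_zero_add' ENNReal.summable, h0, zero_add]
  simp_rw [← ENNReal.tsum_mul_left]
  rw [← Summable.tsum_finsetSum fun _ _ => ENNReal.summable]
  refine ENNReal.tsum_le_tsum fun t => ?_
  have h1 : M.runMeasure s₀ σ {ω | ω (t + 1) = y} ≤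
      M.runMeasure s₀ σ (⋃ i ∈ F, {ω | ω t = f i ∧ ω (t + 1) = y}) := by
    refine measure_mono_ae ?_
    filter_upwards [h] with ω hω hy'
    obtain ⟨i, hi, h'⟩ := hω t hy'
    exact Set.mem_biUnion (x := i) hi ⟨h', hy'⟩
  refine h1.trans ((measure_biUnion_finset_le _ _).trans (Finset.sum_le_sum fun i hi => ?_))
  obtain ⟨hc, hp⟩ := hf i hi
  refine runMeasure_step_le s₀ σ (t := t) (A := {h : M.Hist t | M.last h = f i}) (s := y) ?_
  rintro h (hh : M.last h = f i)
  rw [Strategy.ext_of_notMem _ (hh ▸ hc)]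
  simpa only [hh] using hp

theorem runMeasure_cyl_inter_inter (s₀ : M.State) (σ : M.Strategy) (ρ : ℕ → M.State) (t : ℕ)
    {s : M.State} (hs : s ∉ M.controlled) (s' : M.State) :
    M.runMeasure s₀ σ (cyl ρ t ∩ {ω | ω (t + 1) = s} ∩ {ω | ω (t + 2) = s'}) =
      M.runMeasure s₀ σ (cyl ρ t) * σ.ext t (Preorder.frestrictLe t ρ) s * M.prob s hs s' := by
  classical
  have h := runMeasure_cyl_inter s₀ σ (Function.update ρ (t + 1) s) (t + 1) s'
  have h1 : ∀ i ≤ t, Function.update ρ (t + 1) s i = ρ i := fun i hi =>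
    Function.update_of_ne (by omega) _ _
  have h2 : M.last (Preorder.frestrictLe (t + 1) (Function.update ρ (t + 1) s) : M.Hist (t + 1)) =
      s := Function.update_self _ _ _
  have h3 : σ.ext (t + 1) (Preorder.frestrictLe (t + 1) (Function.update ρ (t + 1) s)) s' =
      M.prob s hs s' := by
    rw [Strategy.ext_of_notMem _ (h2.symm ▸ hs)]
    simp only [h2]
  have h4 : cyl (Function.update ρ (t + 1) s) (t + 1) = cyl ρ t ∩ {ω | ω (t + 1) = s} := by
    rw [cyl_succ, cyl_congr h1, Function.update_self]
  rw [h3, h4, runMeasure_cyl_inter] at h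
  exact h

/-! ### Finite memory: some mode is likely at every possible history. -/

namespace Memory

variable {Mode : Type} (T : M.Memory Mode)

/-- The probability that a mode and a state are followed by a state. -/
noncomputable def succWeight (m : Mode) (s s' : M.State) : ENNReal := ∑' m', T.update m s (m', s')

theorem tsum_succWeight (m : Mode) (s : M.State) : ∑' s', T.succWeight m s s' = 1 := by
  unfold succWeight
  rw [ENNReal.tsum_comm, ← ENNReal.tsum_prod (f := fun m' s' => T.update m s (m', s'))]
  exact (T.update m s).tsum_coe

theorem succWeight_le_one (m : Mode) (s s' : M.State) : T.succWeight m s s' ≤ 1 :=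
  (T.tsum_succWeight m s).symm ▸ ENNReal.le_tsum s'

theorem step_of_succWeight_ne_zero {m : Mode} {s s' : M.State} (hs : s ∈ M.controlled)
    (h : T.succWeight m s s' ≠ 0) : M.step s s' := by
  unfold succWeight at h
  rw [Ne, ENNReal.tsum_eq_zero, not_forall] at h
  obtain ⟨m', hm'⟩ := h
  exact T.update_controlled m s hs (m', s') ((PMF.mem_support_iff _ _).2 hm')

theorem tsum_weight_succ (n : ℕ) (h : M.Hist (n + 1)) :
    ∑' m, T.weight (n + 1) h m = ∑' m', T.weight n (M.initial h) m' *
      T.succWeight m' (M.last (M.initial h)) (M.last h) := by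
  unfold succWeight
  simp only [weight]
  rw [ENNReal.tsum_comm]
  simp_rw [ENNReal.tsum_mul_left]

theorem tsum_weight_le_one : ∀ (n : ℕ) (h : M.Hist n), ∑' m, T.weight n h m ≤ 1
  | 0, h => by
      simp only [weight]
      exact (PMF.pure T.init).tsum_coe.le
  | n + 1, h => by
      rw [tsum_weight_succ]
      refine le_trans (ENNReal.tsum_le_tsum fun m' => ?_) (tsum_weight_le_one n (M.initial h))
      exact mul_le_of_le_one_right' (T.succWeight_le_one _ _ _)

theorem tsum_condMode {n : ℕ} {h : M.Hist n} (hw : ∑' m, T.weight n h m ≠ 0) :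
    ∑' m, T.condMode n h m = 1 := by
  unfold condMode
  simp_rw [div_eq_mul_inv]
  rw [ENNReal.tsum_mul_right]
  exact ENNReal.mul_inv_cancel hw (ne_top_of_le_ne_top ENNReal.one_ne_top (T.tsum_weight_le_one n h))

variable {T}

theorem Implements.act_eq {σ : M.Strategy} (hT : T.Implements σ) {n : ℕ} {h : M.Hist n}
    (hc : M.last h ∈ M.controlled) (hw : ∑' m, T.weight n h m ≠ 0) (s' : M.State) :
    σ.act n h hc s' = ∑' m, T.condMode n h m * T.succWeight m (M.last h) s' := by
  rw [hT n h hc hw s']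
  unfold succWeight
  simp_rw [ENNReal.tsum_mul_left]

/-- Sequences of positive probability have positive weight. -/
theorem Implements.tsum_weight_ne_zero {σ : M.Strategy} (hT : T.Implements σ) (s₀ : M.State)
    (ρ : ℕ → M.State) : ∀ n, M.runMeasure s₀ σ (cyl ρ n) ≠ 0 →
      ∑' m, T.weight n (Preorder.frestrictLe n ρ) m ≠ 0
  | 0, _ => by
      simp only [weight]
      rw [(PMF.pure T.init).tsum_coe]
      exact one_ne_zero
  | n + 1, h => by
      rw [runMeasure_cyl_succ] at h
      have hw := hT.tsum_weight_ne_zero s₀ ρ n (left_ne_zero_of_mul h)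
      have he := right_ne_zero_of_mul h
      rw [tsum_weight_succ]
      change ∑' m', T.weight n (Preorder.frestrictLe n ρ) m' *
        T.succWeight m' (ρ n) (ρ (n + 1)) ≠ 0
      by_cases hc : ρ n ∈ M.controlled
      · rw [σ.ext_of_mem (h := Preorder.frestrictLe n ρ) hc,
          hT.act_eq (h := Preorder.frestrictLe n ρ) hc hw] at he
        rw [Ne, ENNReal.tsum_eq_zero, not_forall] at he ⊢
        obtain ⟨m, hm⟩ := he
        refine ⟨m, mul_ne_zero ?_ (right_ne_zero_of_mul hm)⟩
        have := left_ne_zero_of_mul hm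
        unfold condMode at this
        intro h0
        rw [h0, ENNReal.zero_div] at this
        exact this rfl
      · rw [σ.ext_of_notMem (h := Preorder.frestrictLe n ρ) hc] at he
        have : ∀ m, T.succWeight m (ρ n) (ρ (n + 1)) = M.prob (ρ n) hc (ρ (n + 1)) :=
          fun m => T.update_random m (ρ n) hc (ρ (n + 1))
        simp_rw [this]
        rw [ENNReal.tsum_mul_right]
        exact mul_ne_zero hw he

/-- At every history of positive probability, some mode has probability at least the inverse of the
number of modes. -/
theorem Implements.exists_mode [Finite Mode] {σ : M.Strategy} (hT : T.Implements σ)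
    (s₀ : M.State) {ρ : ℕ → M.State} {t : ℕ} (hc : ρ t ∈ M.controlled)
    (hρ : M.runMeasure s₀ σ (cyl ρ t) ≠ 0) :
    ∃ m, ∀ s', (Nat.card Mode : ENNReal)⁻¹ * T.succWeight m (ρ t) s' ≤
      σ.ext t (Preorder.frestrictLe t ρ) s' := by
  have hw := hT.tsum_weight_ne_zero s₀ ρ t hρ
  have := Fintype.ofFinite Mode
  obtain ⟨m, hm⟩ : ∃ m, (Nat.card Mode : ENNReal)⁻¹ ≤ T.condMode t (Preorder.frestrictLe t ρ) m := by
    by_contra! hlt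
    have hne : (Finset.univ : Finset Mode).Nonempty := ⟨T.init, Finset.mem_univ _⟩
    -- If every mode were less likely than average, the conditional probabilities would sum to less
    -- than 1.
    have h1 := ENNReal.sum_lt_sum_of_nonempty hne fun m _ => hlt m
    rw [← tsum_fintype (L := .unconditional _), T.tsum_condMode hw] at h1
    simp only [Finset.sum_const, Finset.card_univ, nsmul_eq_mul, Nat.card_eq_fintype_card] at h1
    exact absurd h1 (not_lt.2 (ENNReal.mul_inv_le_one _))
  refine ⟨m, fun s' => ?_⟩
  rw [σ.ext_of_mem (h := Preorder.frestrictLe t ρ) hc,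
    hT.act_eq (h := Preorder.frestrictLe t ρ) hc hw]
  exact (mul_le_mul' hm le_rfl).trans (ENNReal.le_tsum (f := fun m =>
    T.condMode t (Preorder.frestrictLe t ρ) m * T.succWeight m (ρ t) s') m)

end Memory

end MDP

theorem PMF.map_apply_of_injective {α β : Type*} (p : PMF α) {f : α → β}
    (hf : Function.Injective f) (a : α) : p.map f (f a) = p a := by
  classical
  rw [PMF.map_apply, tsum_eq_single a]
  · rw [if_pos rfl]
  · intro b hb
    exact if_neg fun h => hb (hf h).symm

/-! ### The MDP: numbers of gadgets, time scales, states and laws. -/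

namespace Restart

/-- The number of gadgets that have `k + 1` levels. -/
def gadgetCount (k : ℕ) : ℕ := (k + 1) * 2 ^ (k * k)

theorem exists_gadget_equiv : Nonempty (ℕ ≃ Σ k : ℕ, Fin (gadgetCount k)) := by
  have : Infinite (Σ k : ℕ, Fin (gadgetCount k)) :=
    Infinite.of_injective
      (fun k : ℕ => (⟨k, ⟨0, by unfold gadgetCount; positivity⟩⟩ : Σ k : ℕ, Fin (gadgetCount k)))
      (fun a b h => congrArg Sigma.fst h)
  exact nonempty_equiv_of_countable

/-- The highest level of the `n`-th gadget, whose levels are `0, …, lev n`. Every level occurs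
`gadgetCount` many times. -/
noncomputable def lev (n : ℕ) : ℕ := (exists_gadget_equiv.some n).1

theorem tsum_lev (f : ℕ → ENNReal) :
    ∑' n, f (lev n) = ∑' k, (gadgetCount k : ENNReal) * f k := by
  unfold lev
  rw [exists_gadget_equiv.some.tsum_eq (fun x : Σ k : ℕ, Fin (gadgetCount k) => f x.1),
    ENNReal.tsum_sigma']
  refine tsum_congr fun k => ?_
  rw [tsum_fintype]
  simp

/-- This balance dictates `gadgetCount`: up to the factor 1/K, the failure bounds of all gadgets
with top level k add up to 1. -/
theorem gadgetCount_mul_pow (k : ℕ) :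
    (gadgetCount k : ENNReal) * (2⁻¹ ^ (k * k) / (k + 1 : ENNReal)) = 1 := by
  unfold gadgetCount
  have h1 : ((k : ENNReal) + 1) ≠ 0 := by positivity
  have h2 : ((k : ENNReal) + 1) ≠ ⊤ := by finiteness
  have h3 : (2 : ENNReal) ^ (k * k) * 2⁻¹ ^ (k * k) = 1 := by
    rw [← mul_pow, ENNReal.mul_inv_cancel (by simp) (by simp), one_pow]
  push_cast
  rw [div_eq_mul_inv]
  calc ((k : ENNReal) + 1) * 2 ^ (k * k) * (2⁻¹ ^ (k * k) * ((k : ENNReal) + 1)⁻¹)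
      = (2 ^ (k * k) * 2⁻¹ ^ (k * k)) * (((k : ENNReal) + 1) * ((k : ENNReal) + 1)⁻¹) := by ring
    _ = 1 := by rw [h3, ENNReal.mul_inv_cancel h1 h2, one_mul]

/-- Relative to the failure bounds, the exponent k(k+1) gains a factor 2^{-k}. Grouping by levels
leaves the convergent series of (k+1)²2^{-k}. -/
theorem tsum_lev_crash_ne_top :
    ∑' n, ((lev n : ENNReal) + 1) * 2⁻¹ ^ (lev n * (lev n + 1)) ≠ ⊤ := by
  rw [tsum_lev (fun k => ((k : ENNReal) + 1) * 2⁻¹ ^ (k * (k + 1)))]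
  have h : ∀ k : ℕ, (gadgetCount k : ENNReal) * (((k : ENNReal) + 1) * 2⁻¹ ^ (k * (k + 1))) =
      ENNReal.ofReal (((k : ℝ) + 1) ^ 2 * (1 / 2) ^ k) := by
    intro k
    unfold gadgetCount
    have h3 : (2 : ENNReal) ^ (k * k) * 2⁻¹ ^ (k * k) = 1 := by
      rw [← mul_pow, ENNReal.mul_inv_cancel (by simp) (by simp), one_pow]
    rw [ENNReal.ofReal_mul (by positivity), ENNReal.ofReal_pow (by positivity),
      ENNReal.ofReal_pow (by positivity), one_div, ENNReal.ofReal_inv_of_pos (by norm_num),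
      ENNReal.ofReal_add (by positivity) (by positivity), ENNReal.ofReal_natCast,
      ENNReal.ofReal_one, ENNReal.ofReal_ofNat]
    push_cast
    rw [mul_add, mul_one, pow_add]
    calc ((k : ENNReal) + 1) * 2 ^ (k * k) * (((k : ENNReal) + 1) * (2⁻¹ ^ (k * k) * 2⁻¹ ^ k))
        = (2 ^ (k * k) * 2⁻¹ ^ (k * k)) * (((k : ENNReal) + 1) ^ 2 * 2⁻¹ ^ k) := by ring
      _ = _ := by rw [h3, one_mul]
  simp_rw [h]
  have hs : Summable fun k : ℕ => ((k : ℝ) + 1) ^ 2 * (1 / 2) ^ k := by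
    have h1 := (summable_nat_add_iff 1).2
      (summable_pow_mul_geometric_of_norm_lt_one 2 (r := (1 / 2 : ℝ)) (by norm_num))
    refine (h1.mul_left 2).congr fun k => ?_
    push_cast
    ring
  exact hs.tsum_ofReal_ne_top

theorem tsum_lev_ge_eq_top (K : ℕ) (c : ENNReal) (hc : c ≠ 0) :
    ∑' n, (if K ≤ lev n then 2⁻¹ ^ (lev n * lev n) / ((lev n : ENNReal) + 1) * c else 0) = ⊤ := by
  rw [tsum_lev (fun k => if K ≤ k then 2⁻¹ ^ (k * k) / ((k : ENNReal) + 1) * c else 0)]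
  rw [← top_le_iff, ← ENNReal.tsum_const_eq_top_of_ne_zero (α := ℕ) hc]
  refine le_trans ?_ (ENNReal.tsum_comp_le_tsum_of_injective (add_left_injective K) _)
  refine ENNReal.tsum_le_tsum fun k => ?_
  simp only [le_add_iff_nonneg_left, zero_le, if_true]
  rw [← mul_assoc, gadgetCount_mul_pow, one_mul]

/-- An upper bound for the time at which the `n`-th gadget is entered. -/
noncomputable def timeBound : ℕ → ℕ
  | 0 => 0
  | n + 1 => timeBound n + 5 + (n + 1) * (timeBound n + n + 4) ^ (lev n + 1)

/-- The loss that is incurred by choosing the level `j` in the `n`-th gadget. -/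
noncomputable def loss (n j : ℕ) : ℕ := (timeBound n + n + 4) ^ (j + 1)

/-- The length of the delay at level `i` of the `n`-th gadget. -/
noncomputable def wait (n i : ℕ) : ℕ := (n + 1) * loss n i

theorem timeBound_succ (n : ℕ) : timeBound (n + 1) = timeBound n + 5 + wait n (lev n) := rfl

theorem loss_mono (n : ℕ) : Monotone (loss n) := fun i j h =>
  Nat.pow_le_pow_right (by omega) (by omega)

theorem wait_mono (n : ℕ) : Monotone (wait n) := fun _ _ h =>
  Nat.mul_le_mul_left _ (loss_mono n h)

/-- The base of the powers in `loss` splits as (n + 1) + (timeBound n + 3): one more factor covers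
both the wait of level `i` and the time before it. -/
theorem time_le_loss {n i j : ℕ} (h : i < j) : timeBound n + 3 + wait n i ≤ loss n j := by
  have h1 : loss n (i + 1) ≤ loss n j := loss_mono n h
  refine le_trans ?_ h1
  unfold wait
  have h2 : loss n (i + 1) = loss n i * (timeBound n + n + 4) := pow_succ _ _
  have h3 : 1 ≤ loss n i := Nat.one_le_pow _ _ (by omega)
  rw [h2]
  nlinarith

/-- The states. From `gate n`, the entry of the `n`-th gadget, a random level `i` leads to a delay
of length `wait n i`, whose states are `delay n i p`. Then, in the controlled state `fork n`, which
does not reveal `i`, a level `j` is chosen. This leads to `dip n j`, where the total reward is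
`-loss n j`, and from there either directly or through `crash n` to the next gadget. -/
inductive St : Type
  | gate (n : ℕ)
  | delay (n i p : ℕ)
  | fork (n : ℕ)
  | dip (n j : ℕ)
  | crash (n : ℕ)

open St

/-- A rank that increases strictly along the transitions; its first component is the index of the
gadget. -/
def rank : St → ℕ ×ₗ ℕ ×ₗ ℕ
  | gate n => toLex (n, toLex (0, 0))
  | delay n _ p => toLex (n, toLex (1, p))
  | fork n => toLex (n, toLex (2, 0))
  | dip n _ => toLex (n, toLex (3, 0))
  | crash n => toLex (n, toLex (4, 0))

/-- The index of the gadget of a state. -/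
def gadget : St → ℕ
  | gate n => n
  | delay n _ _ => n
  | fork n => n
  | dip n _ => n
  | crash n => n

/-- The total reward on arrival in a state. -/
noncomputable def total : St → ℝ
  | dip n j => -(loss n j : ℝ)
  | crash n => -(timeBound (n + 1) : ℝ)
  | _ => 0

/-- The transition relation. -/
inductive Step : St → St → Prop
  | enter (n i : ℕ) (h : i ≤ lev n) : Step (gate n) (delay n i 0)
  | wait (n i p : ℕ) (h : p < Restart.wait n i) : Step (delay n i p) (delay n i (p + 1))
  | arrive (n i p : ℕ) (h : Restart.wait n i ≤ p) : Step (delay n i p) (fork n)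
  | choose (n j : ℕ) (h : j ≤ lev n) : Step (fork n) (dip n j)
  | fail (n j : ℕ) : Step (dip n j) (crash n)
  | recover (n j : ℕ) : Step (dip n j) (gate (n + 1))
  | leave (n : ℕ) : Step (crash n) (gate (n + 1))

theorem countable_St : Countable St := by
  have : Function.Injective (fun s : St => match s with
    | gate n => (0, n, 0, 0)
    | delay n i p => (1, n, i, p)
    | fork n => (2, n, 0, 0)
    | dip n j => (3, n, j, 0)
    | crash n => ((4, n, 0, 0) : ℕ × ℕ × ℕ × ℕ)) := by
    intro s s' h
    cases s <;> cases s' <;> simp_all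
  exact this.countable

/-- The unnormalized probabilities of the levels. -/
noncomputable def levelWeight (k : ℕ) (i : Fin (k + 1)) : ENNReal := 2⁻¹ ^ (k * (k - i))

theorem levelWeight_le_one (k : ℕ) (i : Fin (k + 1)) : levelWeight k i ≤ 1 :=
  pow_le_one₀ zero_le (by simp)

theorem one_le_tsum_levelWeight (k : ℕ) : 1 ≤ ∑' i, levelWeight k i := by
  refine le_trans (le_of_eq ?_) (ENNReal.le_tsum (Fin.last k))
  simp [levelWeight]

theorem tsum_levelWeight_le (k : ℕ) : ∑' i, levelWeight k i ≤ (k : ENNReal) + 1 := by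
  rw [tsum_fintype]
  refine (Finset.sum_le_sum fun i _ => levelWeight_le_one k i).trans ?_
  simp

/-- The distribution of the levels of a gadget with levels `0, …, k`. -/
noncomputable def levelLaw (k : ℕ) : PMF (Fin (k + 1)) :=
  PMF.normalize (levelWeight k)
    (ne_of_gt (lt_of_lt_of_le one_pos (one_le_tsum_levelWeight k)))
    (ne_top_of_le_ne_top (by finiteness) (tsum_levelWeight_le k))

theorem levelLaw_le (k : ℕ) (i : Fin (k + 1)) : levelLaw k i ≤ 2⁻¹ ^ (k * (k - i)) := by
  unfold levelLaw
  rw [PMF.normalize_apply]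
  exact mul_le_of_le_one_right' (ENNReal.inv_le_one.2 (one_le_tsum_levelWeight k))

/-- The normalizing sum has k + 1 terms, each at most 1. -/
theorem le_levelLaw (k : ℕ) (i : Fin (k + 1)) :
    2⁻¹ ^ (k * (k - i)) / ((k : ENNReal) + 1) ≤ levelLaw k i := by
  unfold levelLaw
  rw [PMF.normalize_apply, div_eq_mul_inv]
  exact mul_le_mul' le_rfl (ENNReal.inv_le_inv.2 (tsum_levelWeight_le k))

/-- The probability of a crash after the fork of the level `j`. -/
noncomputable def crashProb (n j : ℕ) : ENNReal := 2⁻¹ ^ (lev n * (j + 1))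

theorem crashProb_le_one (n j : ℕ) : crashProb n j ≤ 1 := pow_le_one₀ zero_le (by simp)

/-- The distribution that decides whether there is a crash. -/
noncomputable def crashLaw (n j : ℕ) : PMF Bool :=
  PMF.ofFintype (fun b => cond b (crashProb n j) (1 - crashProb n j)) (by
    simp [add_tsub_cancel_of_le (crashProb_le_one n j)])

/-- The transition probabilities at the random states. -/
noncomputable def law : St → PMF St
  | gate n => (levelLaw (lev n)).map fun i : Fin (lev n + 1) => delay n i 0
  | delay n i p => PMF.pure (if p < wait n i then delay n i (p + 1) else fork n)
  -- A dummy value: forks are controlled.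
  | fork n => PMF.pure (dip n 0)
  | dip n j => (crashLaw n j).map fun b => cond b (crash n) (gate (n + 1))
  | crash n => PMF.pure (gate (n + 1))

theorem law_gate (n : ℕ) (i : Fin (lev n + 1)) :
    law (gate n) (delay n i 0) = levelLaw (lev n) i := by
  exact PMF.map_apply_of_injective (levelLaw (lev n)) (f := fun i : Fin (lev n + 1) => delay n i 0)
    (fun a b h => by simpa [Fin.ext_iff] using h) i

theorem law_gate_le {n i : ℕ} (hi : i ≤ lev n) :
    law (gate n) (delay n i 0) ≤ 2⁻¹ ^ (lev n * (lev n - i)) := by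
  rw [law_gate n ⟨i, by omega⟩]
  exact levelLaw_le _ _

theorem le_law_gate {n i : ℕ} (hi : i ≤ lev n) :
    2⁻¹ ^ (lev n * (lev n - i)) / ((lev n : ENNReal) + 1) ≤ law (gate n) (delay n i 0) := by
  rw [law_gate n ⟨i, by omega⟩]
  exact le_levelLaw _ ⟨i, by omega⟩

theorem law_dip (n j : ℕ) : law (dip n j) (crash n) = crashProb n j :=
  PMF.map_apply_of_injective (crashLaw n j) (f := fun b => cond b (crash n) (gate (n + 1)))
    (fun a b h => by cases a <;> cases b <;> simp_all) true

theorem step_of_mem_support_law {s s' : St} (hs : ∀ n, s ≠ fork n) (h : s' ∈ (law s).support) :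
    Step s s' := by
  cases s with
  | gate n =>
    obtain ⟨i, -, rfl⟩ := (PMF.mem_support_map_iff _ _ _).1 h
    exact Step.enter n i (Nat.lt_succ_iff.1 i.2)
  | delay n i p =>
    have h' := (PMF.mem_support_pure_iff _ _).1 h
    subst h'
    split_ifs with hp
    · exact Step.wait n i p hp
    · exact Step.arrive n i p (by omega)
  | fork n => exact absurd rfl (hs n)
  | dip n j =>
    obtain ⟨b, -, rfl⟩ := (PMF.mem_support_map_iff _ _ _).1 h
    cases b
    · exact Step.recover n j
    · exact Step.fail n j
  | crash n =>
    have h' := (PMF.mem_support_pure_iff _ _).1 h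
    subst h'
    exact Step.leave n

theorem exists_step (s : St) : ∃ s', Step s s' := by
  by_cases hs : ∃ n, s = fork n
  · obtain ⟨n, rfl⟩ := hs
    exact ⟨_, Step.choose n 0 (Nat.zero_le _)⟩
  · obtain ⟨s', hs'⟩ := (law s).support_nonempty
    exact ⟨s', step_of_mem_support_law (fun n h => hs ⟨n, h⟩) hs'⟩

/-- The Markov decision process. -/
noncomputable def restart : MDP where
  State := St
  countable_state := countable_St
  controlled := Set.range fork
  step := Step
  exists_step := exists_step
  prob := fun s _ => law s
  prob_support _ hs _ h := step_of_mem_support_law (fun n hn => hs ⟨n, hn.symm⟩) h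
  -- Rewards are differences of a potential, so the total reward telescopes and is implicit in the
  -- state.
  reward s s' := total s' - total s

theorem finitelyBranching : restart.FinitelyBranching := by
  intro s
  change {s' | Step s s'}.Finite
  cases s with
  | gate n =>
    refine ((Set.finite_Iic (lev n)).image fun i => delay n i 0).subset ?_
    rintro _ ⟨_, i, hi⟩
    exact ⟨i, hi, rfl⟩
  | delay n i p =>
    refine (Set.toFinite {delay n i (p + 1), fork n}).subset ?_
    rintro _ (_ | _) <;> simp
  | fork n =>
    refine ((Set.finite_Iic (lev n)).image fun j => dip n j).subset ?_
    rintro _ h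
    rcases h with _ | _ | _ | ⟨_, j, hj⟩
    exact ⟨j, hj, rfl⟩
  | dip n j =>
    refine (Set.toFinite {crash n, gate (n + 1)}).subset ?_
    rintro _ (_ | _) <;> simp
  | crash n =>
    refine (Set.toFinite {gate (n + 1)}).subset ?_
    rintro _ ⟨⟩
    simp

theorem rank_lt {s s' : St} (h : Step s s') : rank s < rank s' := by
  cases h <;> simp [rank, Prod.Lex.toLex_lt_toLex]

theorem acyclic : restart.Acyclic := by
  have key : ∀ s s' : St, Relation.TransGen Step s s' → rank s < rank s' := by
    intro s s' h
    induction h with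
    | single h => exact rank_lt h
    | tail _ h ih => exact ih.trans (rank_lt h)
  exact fun s h => lt_irrefl _ (key s s h)

theorem totalReward_eq {ω : ℕ → restart.State} (hω : ω 0 = gate 0) (n : ℕ) :
    restart.totalReward ω n = total (ω n) := by
  have h := Finset.sum_range_sub (fun j => total (ω j)) n
  have h0 : total (ω 0) = 0 := by rw [hω]; rfl
  rw [h0, sub_zero] at h
  exact h

theorem totalRewardImplicit : restart.TotalRewardImplicit (gate 0) := by
  intro s
  refine ⟨total s, fun ρ hρ n hn => ?_⟩
  rw [totalReward_eq hρ.1, hn]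

theorem step_run {ω : ℕ → restart.State} (hω : ω ∈ restart.runs (gate 0)) (t : ℕ) :
    Step (ω t) (ω (t + 1)) := hω.2 t

theorem rank_run_strictMono {ω : ℕ → restart.State} (hω : ω ∈ restart.runs (gate 0)) :
    StrictMono fun t => rank (ω t) :=
  strictMono_nat_of_lt_succ fun t => rank_lt (step_run hω t)

end Restart

/-! ### The shape of runs, and the mean payoff in terms of dips and crashes. -/

namespace Restart
open St

theorem run_of_gate {ω : ℕ → restart.State} (hω : ω ∈ restart.runs (gate 0)) {t n : ℕ}
    (h : ω t = gate n) : ∃ i ≤ lev n, ω (t + 1) = delay n i 0 := by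
  have hs := step_run hω t
  rw [h] at hs
  generalize ω (t + 1) = s at hs
  cases hs with
  | enter n i hi => exact ⟨i, hi, rfl⟩

theorem run_of_delay_lt {ω : ℕ → restart.State} (hω : ω ∈ restart.runs (gate 0)) {t n i p : ℕ}
    (h : ω t = delay n i p) (hp : p < wait n i) : ω (t + 1) = delay n i (p + 1) := by
  have hs := step_run hω t
  rw [h] at hs
  generalize ω (t + 1) = s at hs
  cases hs with
  | wait => rfl
  | arrive _ _ _ h' => omega

theorem run_of_delay_ge {ω : ℕ → restart.State} (hω : ω ∈ restart.runs (gate 0)) {t n i p : ℕ}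
    (h : ω t = delay n i p) (hp : wait n i ≤ p) : ω (t + 1) = fork n := by
  have hs := step_run hω t
  rw [h] at hs
  generalize ω (t + 1) = s at hs
  cases hs with
  | wait _ _ _ h' => omega
  | arrive => rfl

theorem run_of_fork {ω : ℕ → restart.State} (hω : ω ∈ restart.runs (gate 0)) {t n : ℕ}
    (h : ω t = fork n) : ∃ j ≤ lev n, ω (t + 1) = dip n j := by
  have hs := step_run hω t
  rw [h] at hs
  generalize ω (t + 1) = s at hs
  cases hs with
  | choose _ j hj => exact ⟨j, hj, rfl⟩

theorem run_of_dip {ω : ℕ → restart.State} (hω : ω ∈ restart.runs (gate 0)) {t n j : ℕ}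
    (h : ω t = dip n j) : ω (t + 1) = crash n ∨ ω (t + 1) = gate (n + 1) := by
  have hs := step_run hω t
  rw [h] at hs
  generalize ω (t + 1) = s at hs
  cases hs with
  | fail => exact Or.inl rfl
  | recover => exact Or.inr rfl

theorem run_of_crash {ω : ℕ → restart.State} (hω : ω ∈ restart.runs (gate 0)) {t n : ℕ}
    (h : ω t = crash n) : ω (t + 1) = gate (n + 1) := by
  have hs := step_run hω t
  rw [h] at hs
  generalize ω (t + 1) = s at hs
  cases hs with
  | leave => rfl

theorem run_delay_add {ω : ℕ → restart.State} (hω : ω ∈ restart.runs (gate 0)) {t n i : ℕ}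
    (h : ω t = delay n i 0) : ∀ p ≤ wait n i, ω (t + p) = delay n i p
  | 0, _ => h
  | p + 1, hp => run_of_delay_lt hω (run_delay_add hω h p (by omega)) (by omega)

theorem exists_run_eq_gate {ω : ℕ → restart.State} (hω : ω ∈ restart.runs (gate 0)) :
    ∀ n, ∃ t ≤ timeBound n, ω t = gate n
  | 0 => ⟨0, Nat.zero_le _, hω.1⟩
  | n + 1 => by
    obtain ⟨t, ht, h⟩ := exists_run_eq_gate hω n
    obtain ⟨i, hi, h1⟩ := run_of_gate hω h
    have h2 := run_of_delay_ge hω (run_delay_add hω h1 _ le_rfl) le_rfl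
    obtain ⟨j, hj, h3⟩ := run_of_fork hω h2
    have hw := wait_mono n hi
    rw [timeBound_succ]
    rcases run_of_dip hω h3 with h4 | h4
    · exact ⟨_, by omega, run_of_crash hω h4⟩
    · exact ⟨_, by omega, h4⟩

theorem rank_lt_of_gadget_lt {s : St} {n : ℕ} (h : gadget s < n) : rank s < rank (gate n) := by
  cases s <;> simp_all [rank, gadget, Prod.Lex.toLex_lt_toLex]

/-- The rank increases along the run and is smaller in gadgets up to `n` than at the next gate,
which is reached by `timeBound (n + 1)`. -/
theorem time_lt_of_gadget_le {ω : ℕ → restart.State} (hω : ω ∈ restart.runs (gate 0)) {t n : ℕ}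
    (h : gadget (ω t) ≤ n) : t < timeBound (n + 1) := by
  obtain ⟨u, hu, h'⟩ := exists_run_eq_gate hω (n + 1)
  refine lt_of_lt_of_le ((rank_run_strictMono hω).lt_iff_lt.1 ?_) hu
  simp only [h']
  exact rank_lt_of_gadget_lt (Nat.lt_succ_of_le h)

theorem run_injective {ω : ℕ → restart.State} (hω : ω ∈ restart.runs (gate 0)) :
    Function.Injective ω := fun _ _ h =>
  (rank_run_strictMono hω).injective (congrArg rank h)

theorem time_le_of_gate {ω : ℕ → restart.State} (hω : ω ∈ restart.runs (gate 0)) {t n : ℕ}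
    (h : ω t = gate n) : t ≤ timeBound n := by
  obtain ⟨u, hu, h'⟩ := exists_run_eq_gate hω n
  exact run_injective hω (h.trans h'.symm) ▸ hu

theorem gadget_run_succ {ω : ℕ → restart.State} (hω : ω ∈ restart.runs (gate 0)) (t : ℕ) :
    gadget (ω t) ≤ gadget (ω (t + 1)) ∧ gadget (ω (t + 1)) ≤ gadget (ω t) + 1 := by
  have hs := step_run hω t
  generalize ω (t + 1) = s' at *
  generalize ω t = s at *
  cases hs <;> simp [gadget]

theorem gadget_run_le {ω : ℕ → restart.State} (hω : ω ∈ restart.runs (gate 0)) :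
    ∀ t, gadget (ω t) ≤ t
  | 0 => by rw [hω.1]; exact le_rfl
  | t + 1 => (gadget_run_succ hω t).2.trans (Nat.succ_le_succ (gadget_run_le hω t))

/-- The bound `p ≤ t` records that a completed delay has used up its waiting time, the time against
which the loss is later measured. -/
theorem bounds_of_delay {ω : ℕ → restart.State} (hω : ω ∈ restart.runs (gate 0)) {n i : ℕ} :
    ∀ {t p : ℕ}, ω t = delay n i p → p ≤ t ∧ p ≤ wait n i ∧ i ≤ lev n
  | 0, p, h => by
    rw [hω.1] at h
    cases h
  | t + 1, p, h => by
    have hs := step_run hω t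
    rw [h] at hs
    generalize hx : ω t = s at hs
    cases hs with
    | enter _ _ hi => exact ⟨Nat.zero_le _, Nat.zero_le _, hi⟩
    | wait _ _ p hp =>
      have := bounds_of_delay hω hx
      exact ⟨by omega, by omega, this.2.2⟩

/-- The runs whose mean payoff is at most `-1` at some time in the `n`-th gadget. -/
def failure (n : ℕ) : Set (ℕ → restart.State) :=
  {ω | ∃ t, 0 < t ∧ gadget (ω t) = n ∧ total (ω t) ≤ -(t : ℝ)}

/-- The `n`-th gadget is not reached before time `n`, so failures in arbitrarily late gadgets occur
at arbitrarily late times. -/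
theorem notMem_meanPayoff {ω : ℕ → restart.State} (hf : ∀ N, ∃ n ≥ N, ω ∈ failure n) :
    ω ∉ restart.meanPayoffLiminfNonneg (gate 0) := by
  rintro ⟨hω, h⟩
  have h1 : liminf (fun n : ℕ => ((1 / (n : ℝ) * restart.totalReward ω n : ℝ) : EReal)) atTop ≤
      ((-1 : ℝ) : EReal) := by
    refine liminf_le_of_frequently_le' (frequently_atTop.2 fun N => ?_)
    obtain ⟨n, hn, t, ht, hg, hr⟩ := hf N
    refine ⟨t, hn.trans (hg ▸ gadget_run_le hω t), ?_⟩
    rw [totalReward_eq hω.1, EReal.coe_le_coe_iff]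
    have ht' : (0 : ℝ) < t := Nat.cast_pos.2 ht
    rw [one_div, inv_mul_le_iff₀ ht']
    linarith
  have h2 := h.trans h1
  rw [← EReal.coe_zero, EReal.coe_le_coe_iff] at h2
  linarith

/-- Outside dips and crashes the total reward is 0. At a dip of gadget `n`, hypothesis `hd` bounds
the loss by t/(n+1). -/
theorem mem_meanPayoff {ω : ℕ → restart.State} (hω : ω ∈ restart.runs (gate 0)) {N : ℕ}
    (hc : ∀ n ≥ N, ∀ t, ω t ≠ crash n) (hd : ∀ t n j, ω t = dip n j → wait n j ≤ t) :
    ω ∈ restart.meanPayoffLiminfNonneg (gate 0) := by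
  refine ⟨hω, le_of_forall_lt fun c hc0 => ?_⟩
  obtain ⟨r, hcr, hr⟩ := EReal.lt_iff_exists_real_btwn.1 hc0
  refine hcr.trans_le (le_liminf_of_le (by isBoundedDefault) ?_)
  have hr0 : r < 0 := by exact_mod_cast hr
  obtain ⟨m, hm⟩ := exists_nat_gt (-r)⁻¹
  filter_upwards [eventually_ge_atTop (timeBound (N + m + 1))] with t ht
  have hg : N + m < gadget (ω t) := by
    by_contra! hle
    exact absurd (time_lt_of_gadget_le hω hle) (by omega)
  have ht0 : 0 < t := lt_of_le_of_lt (Nat.zero_le _) (hg.trans_le (gadget_run_le hω t))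
  have ht' : (0 : ℝ) < t := Nat.cast_pos.2 ht0
  rw [totalReward_eq hω.1, EReal.coe_le_coe_iff, one_div, le_inv_mul_iff₀ ht']
  cases hs : ω t with
  | dip n j =>
    rw [hs] at hg
    have h1 := hd t n j hs
    simp only [total, gadget] at hg ⊢
    have h2 : ((n : ℝ) + 1) * loss n j ≤ t := by
      unfold wait at h1
      exact_mod_cast h1
    have h3 : (m : ℝ) ≤ n := by exact_mod_cast (by omega : m ≤ n)
    have h4 : 1 ≤ -r * (n + 1) := by
      have : (-r)⁻¹ ≤ (n : ℝ) + 1 := by linarith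
      rwa [inv_le_iff_one_le_mul₀' (by linarith)] at this
    have h5 : (0 : ℝ) ≤ loss n j := Nat.cast_nonneg _
    nlinarith
  | crash n =>
    rw [hs] at hg
    simp only [gadget] at hg
    exact absurd hs (hc n (by omega) t)
  | gate n => simp only [total]; nlinarith
  | delay n i p => simp only [total]; nlinarith
  | fork n => simp only [total]; nlinarith

end Restart

/-! ### The strategy that looks back at the delay wins almost surely. -/

namespace Restart
open St MDP

/-- The level of the delay in a state. -/
def delayLevel : St → ℕ
  | delay _ i _ => i
  | _ => 0

/-- The choice of the level of the preceding delay. -/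
noncomputable def followDelay (s : St) : St → St
  -- The minimum only keeps the choice legal at sequences that are not partial runs.
  | fork n => dip n (min (delayLevel s) (lev n))
  | s' => s'

/-- The strategy that chooses the level of the preceding delay. -/
noncomputable def delayStrategy : restart.Strategy where
  act t h _ := PMF.pure
    (followDelay (h ⟨t - 1, Finset.mem_Iic.2 (Nat.sub_le t 1)⟩) (restart.last h))
  act_support t h hc s' hs := by
    obtain ⟨n, hn⟩ := hc
    have hs' := (PMF.mem_support_pure_iff _ _).1 hs
    subst hs'
    rw [← hn]
    exact Step.choose n _ (min_le_right _ _)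

theorem delayStrategy_isDeterministic : delayStrategy.IsDeterministic :=
  fun _ _ _ => ⟨_, rfl⟩

theorem pred_of_dip {ω : ℕ → restart.State} (hω : ω ∈ restart.runs (gate 0)) {t n j : ℕ}
    (h : ω (t + 1) = dip n j) : ω t = fork n ∧ j ≤ lev n := by
  have hs := step_run hω t
  rw [h] at hs
  generalize ω t = s at hs
  cases hs with
  | choose _ _ hj => exact ⟨rfl, hj⟩

theorem pred_of_fork {ω : ℕ → restart.State} (hω : ω ∈ restart.runs (gate 0)) {t n : ℕ}
    (h : ω (t + 1) = fork n) : ∃ i, ω t = delay n i (wait n i) := by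
  have hs := step_run hω t
  rw [h] at hs
  generalize hx : ω t = s at hs
  cases hs with
  | arrive _ i p hp =>
    have := (bounds_of_delay hω hx).2.1
    obtain rfl : p = wait n i := by omega
    exact ⟨i, rfl⟩

theorem pred_of_crash {ω : ℕ → restart.State} (hω : ω ∈ restart.runs (gate 0)) {t n : ℕ}
    (h : ω (t + 1) = crash n) : ∃ j ≤ lev n, ω t = dip n j := by
  have hs := step_run hω t
  rw [h] at hs
  generalize hx : ω t = s at hs
  cases hs with
  | fail _ j =>
    cases t with
    | zero =>
      rw [hω.1] at hx
      cases hx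
    | succ t => exact ⟨j, (pred_of_dip hω hx).2, rfl⟩

theorem pred_of_delay_zero {ω : ℕ → restart.State} (hω : ω ∈ restart.runs (gate 0)) {t n i : ℕ}
    (h : ω (t + 1) = delay n i 0) : ω t = gate n := by
  have hs := step_run hω t
  rw [h] at hs
  generalize ω t = s at hs
  cases hs with
  | enter => rfl

theorem pred_of_delay_succ {ω : ℕ → restart.State} (hω : ω ∈ restart.runs (gate 0))
    {t n i p : ℕ} (h : ω (t + 1) = delay n i (p + 1)) : ω t = delay n i p := by
  have hs := step_run hω t
  rw [h] at hs
  generalize ω t = s at hs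
  cases hs with
  | wait => rfl

theorem ae_delayStrategy :
    ∀ᵐ ω ∂restart.runMeasure (gate 0) delayStrategy, ω ∈ restart.runs (gate 0) ∧
      ∀ t n j, ω (t + 2) = dip n j → ω t = delay n j (wait n j) := by
  filter_upwards [ae_mem_runs (M := restart) (gate 0) delayStrategy,
    ae_ext_ne_zero (M := restart) (gate 0) delayStrategy] with ω hω he
  refine ⟨hω, fun t n j h => ?_⟩
  obtain ⟨h1, -⟩ := pred_of_dip hω h
  obtain ⟨i, h2⟩ := pred_of_fork hω h1
  have hi := (bounds_of_delay hω h2).2.2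
  have h3 := he (t + 1)
  have hc : restart.last (Preorder.frestrictLe (t + 1) ω : restart.Hist (t + 1)) ∈
      restart.controlled := ⟨n, h1.symm⟩
  rw [Strategy.ext_of_mem _ hc] at h3
  have h4 : ω (t + 2) = followDelay (ω t) (ω (t + 1)) :=
    (PMF.mem_support_pure_iff _ _).1 ((PMF.mem_support_iff _ _).2 h3)
  rw [h, h1, h2] at h4
  have h5 : j = min i (lev n) := by
    injection h4
  rw [min_eq_left hi] at h5
  rw [h5, h2]

theorem notMem_controlled {s : St} (hs : ∀ n, s ≠ fork n) :
    (s : restart.State) ∉ restart.controlled :=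
  fun ⟨n, hn⟩ => hs n hn.symm

/-- The gate is visited at most once, and positions after the first in a delay are reached only from
the preceding one. -/
theorem visits_delay_le (σ : restart.Strategy) {n i : ℕ} (hi : i ≤ lev n) :
    ∀ p, visits (M := restart) (gate 0) σ (delay n i p) ≤ 2⁻¹ ^ (lev n * (lev n - i))
  | 0 => by
    have h1 := visits_le_of_ae_pred_mem (M := restart) (s₀ := gate 0) (σ := σ)
      (y := delay n i 0) {()} (fun _ => gate n) (fun _ => 2⁻¹ ^ (lev n * (lev n - i)))
      (fun _ _ => ⟨notMem_controlled (by intro n h; cases h), law_gate_le hi⟩)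
      (by intro h; cases h) (by
        filter_upwards [ae_mem_runs (M := restart) (gate 0) σ] with ω hω t h
        exact ⟨(), by simp, pred_of_delay_zero hω h⟩)
    refine h1.trans ?_
    rw [Finset.sum_singleton]
    exact mul_le_of_le_one_right' (acyclic.visits_le_one _ _ _)
  | p + 1 => by
    refine le_trans (visits_le_of_ae_pred 1 ?_) (visits_delay_le σ hi p)
    filter_upwards [ae_mem_runs (M := restart) (gate 0) σ] with ω hω
    refine ⟨fun t ht h => ?_, fun t h => pred_of_delay_succ hω h⟩
    obtain rfl : t = 0 := by omega
    rw [hω.1] at h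
    cases h

theorem two_le_of_dip {ω : ℕ → restart.State} (hω : ω ∈ restart.runs (gate 0)) {n j : ℕ} :
    ∀ {t : ℕ}, ω t = dip n j → 2 ≤ t
  | 0, h => by
    rw [hω.1] at h
    cases h
  | 1, h => by
    have h1 := (pred_of_dip hω h).1
    rw [hω.1] at h1
    cases h1
  | t + 2, _ => Nat.le_add_left 2 t

theorem visits_dip_le (n j : ℕ) : visits (M := restart) (gate 0) delayStrategy (dip n j) ≤
    visits (M := restart) (gate 0) delayStrategy (delay n j (wait n j)) := by
  refine visits_le_of_ae_pred 2 ?_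
  filter_upwards [ae_delayStrategy] with ω hω
  exact ⟨fun t ht h => absurd (two_le_of_dip hω.1 h) (by omega), fun t h => hω.2 t n j h⟩

theorem visits_crash_le (σ : restart.Strategy) (n : ℕ) :
    visits (M := restart) (gate 0) σ (crash n) ≤ ∑ j ∈ Finset.range (lev n + 1),
      crashProb n j * visits (M := restart) (gate 0) σ (dip n j) := by
  refine visits_le_of_ae_pred_mem (M := restart) _ (fun j => dip n j) _
    (fun j _ => ⟨notMem_controlled (by intro n h; cases h), (law_dip n j).le⟩)
    (by intro h; cases h) ?_
  filter_upwards [ae_mem_runs (M := restart) (gate 0) σ] with ω hω t h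
  obtain ⟨j, hj, h'⟩ := pred_of_crash hω h
  exact ⟨j, Finset.mem_range.2 (Nat.lt_succ_of_le hj), h'⟩

theorem visits_delayStrategy_crash_le (n : ℕ) :
    visits (M := restart) (gate 0) delayStrategy (crash n) ≤
      ((lev n : ENNReal) + 1) * 2⁻¹ ^ (lev n * (lev n + 1)) := by
  refine (visits_crash_le _ n).trans ?_
  have h : ∀ j ∈ Finset.range (lev n + 1),
      crashProb n j * visits (M := restart) (gate 0) delayStrategy (dip n j) ≤
        2⁻¹ ^ (lev n * (lev n + 1)) := by
    intro j hj
    have hj' : j ≤ lev n := Nat.lt_succ_iff.1 (Finset.mem_range.1 hj)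
    refine (mul_le_mul' le_rfl ((visits_dip_le n j).trans (visits_delay_le _ hj' _))).trans ?_
    unfold crashProb
    rw [← pow_add, ← mul_add]
    -- The level cancels: a likely level is met by a small crash probability, with the same product
    -- for all levels.
    have : j + 1 + (lev n - j) = lev n + 1 := by omega
    rw [this]
  refine (Finset.sum_le_sum h).trans ?_
  simp

theorem runMeasure_delayStrategy :
    restart.runMeasure (gate 0) delayStrategy (restart.meanPayoffLiminfNonneg (gate 0)) = 1 := by
  have hb : ∑' n, restart.runMeasure (gate 0) delayStrategy {ω | ∃ t, ω t = crash n} ≠ ⊤ := by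
    refine ne_top_of_le_ne_top tsum_lev_crash_ne_top (ENNReal.tsum_le_tsum fun n => ?_)
    refine le_trans ?_ (visits_delayStrategy_crash_le n)
    rw [Set.ofPred_exists]
    exact measure_iUnion_le _
  have h : ∀ᵐ ω ∂restart.runMeasure (gate 0) delayStrategy,
      ω ∈ restart.meanPayoffLiminfNonneg (gate 0) := by
    filter_upwards [ae_eventually_notMem hb, ae_delayStrategy] with ω h1 h2
    obtain ⟨N, hN⟩ := eventually_atTop.1 h1
    refine mem_meanPayoff h2.1 (N := N) (fun n hn t ht => hN n hn ⟨t, ht⟩) ?_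
    intro t n j hd
    -- Two steps before the dip the run completes a delay of the same level, so the required time
    -- has passed.
    obtain ⟨u, rfl⟩ := Nat.exists_eq_add_of_le' (two_le_of_dip h2.1 hd)
    have := (bounds_of_delay h2.1 (h2.2 u n j hd)).1
    omega
  exact (measure_congr (eventuallyEq_univ.2 h)).trans (measure_univ (μ := MDP.runMeasure restart _ _))

end Restart

/-! ### Finite memory: the probability of a failure within one gadget. -/

namespace Restart
open St MDP

/-- The continuation of `ρ` after time `t` by a delay of level `i` in the `n`-th gadget. -/
noncomputable def delayPath (ρ : ℕ → restart.State) (t n i : ℕ) : ℕ → restart.State := fun u =>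
  if u ≤ t then ρ u else if u ≤ t + 1 + wait n i then delay n i (u - (t + 1)) else fork n

theorem delayPath_of_le (ρ : ℕ → restart.State) {t n i u : ℕ} (h : u ≤ t) :
    delayPath ρ t n i u = ρ u := if_pos h

theorem delayPath_delay (ρ : ℕ → restart.State) {t n i p : ℕ} (h : p ≤ wait n i) :
    delayPath ρ t n i (t + 1 + p) = delay n i p := by
  refine (if_neg (by omega)).trans ((if_pos (by omega)).trans ?_)
  exact congrArg (delay n i) (by omega)

theorem delayPath_fork (ρ : ℕ → restart.State) (t n i : ℕ) :
    delayPath ρ t n i (t + 1 + wait n i + 1) = fork n :=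
  (if_neg (by omega)).trans (if_neg (by omega))

variable {σ : restart.Strategy}

theorem ext_of_ne_fork {s : St} (hs : ∀ n, s ≠ fork n) {ρ : ℕ → restart.State} {t : ℕ}
    (h : ρ t = s) (s' : St) : σ.ext t (Preorder.frestrictLe t ρ) s' = law s s' := by
  have hc : restart.last (Preorder.frestrictLe t ρ : restart.Hist t) ∉ restart.controlled :=
    notMem_controlled fun n hn => hs n (h.symm.trans hn)
  rw [Strategy.ext_of_notMem _ hc]
  change law (ρ t) s' = law s s'
  exact congrArg (fun x => law x s') h

theorem runMeasure_delayPath_delay {ρ : ℕ → restart.State} {t n : ℕ} (h : ρ t = gate n) (i : ℕ) :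
    ∀ p ≤ wait n i, restart.runMeasure (gate 0) σ (cyl (delayPath ρ t n i) (t + 1 + p)) =
      restart.runMeasure (gate 0) σ (cyl ρ t) * law (gate n) (delay n i 0)
  | 0, _ => by
    have h1 := runMeasure_cyl_succ (M := restart) (gate 0) σ (delayPath ρ t n i) t
    rw [cyl_congr (t := t) (fun u hu => delayPath_of_le ρ hu)] at h1
    refine h1.trans (congrArg _ ?_)
    refine (ext_of_ne_fork (s := gate n) (by intro n h; cases h)
      ((delayPath_of_le ρ le_rfl).trans h) _).trans ?_
    exact congrArg _ (delayPath_delay ρ (Nat.zero_le _))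
  | p + 1, hp => by
    rw [← runMeasure_delayPath_delay h i p (by omega)]
    refine (runMeasure_cyl_succ (M := restart) (gate 0) σ (delayPath ρ t n i) (t + 1 + p)).trans ?_
    have h1 : σ.ext (t + 1 + p) (Preorder.frestrictLe (t + 1 + p) (delayPath ρ t n i))
        (delayPath ρ t n i (t + 1 + p + 1)) = 1 := by
      refine (ext_of_ne_fork (s := delay n i p) (by intro n h; cases h)
        (delayPath_delay ρ (by omega)) _).trans ?_
      refine (congrArg (law (delay n i p)) (delayPath_delay ρ hp)).trans ?_
      simp only [law]
      rw [if_pos (by omega)]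
      exact (PMF.pure_apply _ _).trans (if_pos rfl)
    rw [h1, mul_one]

/-- Only the draw of the level is random; every later step up to the fork has probability 1. -/
theorem runMeasure_delayPath {ρ : ℕ → restart.State} {t n : ℕ} (h : ρ t = gate n) (i : ℕ) :
    restart.runMeasure (gate 0) σ (cyl (delayPath ρ t n i) (t + 1 + wait n i + 1)) =
      restart.runMeasure (gate 0) σ (cyl ρ t) * law (gate n) (delay n i 0) := by
  rw [← runMeasure_delayPath_delay h i (wait n i) le_rfl]
  refine (runMeasure_cyl_succ (M := restart) (gate 0) σ (delayPath ρ t n i)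
    (t + 1 + wait n i)).trans ?_
  have h1 : σ.ext (t + 1 + wait n i) (Preorder.frestrictLe (t + 1 + wait n i) (delayPath ρ t n i))
      (delayPath ρ t n i (t + 1 + wait n i + 1)) = 1 := by
    refine (ext_of_ne_fork (s := delay n i (wait n i)) (by intro n h; cases h)
      (delayPath_delay ρ le_rfl) _).trans ?_
    refine (congrArg (law (delay n i (wait n i))) (delayPath_fork ρ t n i)).trans ?_
    simp only [law]
    rw [if_neg (lt_irrefl _)]
    exact (PMF.pure_apply _ _).trans (if_pos rfl)
  rw [h1, mul_one]

/-- The event that the delay of level `i` is followed by the choice of the level `j`. -/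
def choiceEvent (ρ : ℕ → restart.State) (t n i j : ℕ) : Set (ℕ → restart.State) :=
  cyl (delayPath ρ t n i) (t + 1 + wait n i + 1) ∩ {ω | ω (t + 1 + wait n i + 1 + 1) = dip n j}

/-- The event that the delay of level `i` is followed by the choice of the level `j` and a crash. -/
def crashEvent (ρ : ℕ → restart.State) (t n i j : ℕ) : Set (ℕ → restart.State) :=
  choiceEvent ρ t n i j ∩ {ω | ω (t + 1 + wait n i + 1 + 2) = crash n}

theorem choiceEvent_subset_cyl (ρ : ℕ → restart.State) (t n i j : ℕ) :
    choiceEvent ρ t n i j ⊆ cyl ρ t := fun ω hω u hu =>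
  (hω.1 u (by omega)).trans (delayPath_of_le ρ hu)

theorem apply_of_mem_choiceEvent {ρ ω : ℕ → restart.State} {t n i j : ℕ}
    (hω : ω ∈ choiceEvent ρ t n i j) : ω (t + 1) = delay n i 0 :=
  (hω.1 (t + 1) (by omega)).trans (delayPath_delay ρ (Nat.zero_le _))

theorem eq_of_mem_choiceEvent {ρ ω : ℕ → restart.State} {t n i i' j j' : ℕ}
    (hω : ω ∈ choiceEvent ρ t n i j) (hω' : ω ∈ choiceEvent ρ t n i' j') : i = i' ∧ j = j' := by
  have h1 : delay n i 0 = delay n i' 0 :=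
    (apply_of_mem_choiceEvent hω).symm.trans (apply_of_mem_choiceEvent hω')
  obtain rfl : i = i' := by injection h1
  have h2 : dip n j = dip n j' := Eq.trans (Eq.symm hω.2) hω'.2
  exact ⟨rfl, by injection h2⟩

theorem choiceEvent_subset_failure {ρ : ℕ → restart.State} {t n i j : ℕ} (ht : t ≤ timeBound n)
    (hij : i < j) : choiceEvent ρ t n i j ⊆ failure n := by
  intro ω hω
  have h : ω (t + 1 + wait n i + 1 + 1) = dip n j := hω.2
  refine ⟨t + 1 + wait n i + 1 + 1, by omega, by rw [h]; rfl, ?_⟩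
  rw [h]
  have := time_le_loss (n := n) hij
  simp only [total, neg_le_neg_iff]
  exact_mod_cast (by omega)

/-- The crash total is minus `timeBound (n + 1)`, which covers any time spent in the gadget,
whatever the chosen level. -/
theorem crashEvent_subset_failure {ρ : ℕ → restart.State} {t n i j : ℕ} (ht : t ≤ timeBound n)
    (hi : i ≤ lev n) : crashEvent ρ t n i j ⊆ failure n := by
  intro ω hω
  have h : ω (t + 1 + wait n i + 1 + 2) = crash n := hω.2
  refine ⟨t + 1 + wait n i + 1 + 2, by omega, by rw [h]; rfl, ?_⟩
  rw [h]
  have h1 := timeBound_succ n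
  have h2 := wait_mono n hi
  simp only [total, neg_le_neg_iff]
  exact_mod_cast (by omega)

theorem measurableSet_choiceEvent (ρ : ℕ → restart.State) (t n i j : ℕ) :
    MeasurableSet (choiceEvent ρ t n i j) :=
  (measurableSet_cyl _ _).inter (measurableSet_eval_eq _ _)

theorem measurableSet_crashEvent (ρ : ℕ → restart.State) (t n i j : ℕ) :
    MeasurableSet (crashEvent ρ t n i j) :=
  (measurableSet_choiceEvent ρ t n i j).inter (measurableSet_eval_eq _ _)

theorem measurableSet_failure (n : ℕ) : MeasurableSet (failure n) := by
  have : failure n = ⋃ t : ℕ, (fun ω : ℕ → restart.State => ω t) ⁻¹'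
      {s | 0 < t ∧ gadget s = n ∧ total s ≤ -(t : ℝ)} := by
    ext ω
    simp [failure]
  rw [this]
  exact MeasurableSet.iUnion fun t =>
    measurable_pi_apply (X := fun _ : ℕ => restart.State) t MeasurableSet.of_discrete

theorem sum_succWeight_dip {Mode : Type} (T : restart.Memory Mode) (m : Mode) (n : ℕ) :
    ∑ j ∈ Finset.range (lev n + 1), T.succWeight m (fork n) (dip n j) = 1 := by
  classical
  have h1 := T.tsum_succWeight m (fork n)
  have h2 := tsum_eq_sum (f := fun s : restart.State => T.succWeight m (fork n) s)
    (L := .unconditional _)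
    (s := (Finset.range (lev n + 1)).image fun j => (dip n j : restart.State)) (by
      intro s hs
      by_contra hne
      have h1 : Step (fork n) s := T.step_of_succWeight_ne_zero ⟨n, rfl⟩ hne
      apply hs
      cases h1 with
      | choose _ j hj => exact Finset.mem_image.2 ⟨j, Finset.mem_range.2 (by omega), rfl⟩)
  have h3 := Finset.sum_image (f := fun s : restart.State => T.succWeight m (fork n) s)
    (s := Finset.range (lev n + 1)) (g := fun j => (dip n j : restart.State)) (by
      intro a _ b _ h
      have h' : dip n a = dip n b := h
      injection h')
  exact h3.symm.trans (h2.symm.trans h1)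

theorem runMeasure_choiceEvent {ρ : ℕ → restart.State} {t n : ℕ} (h : ρ t = gate n) (i j : ℕ) :
    restart.runMeasure (gate 0) σ (choiceEvent ρ t n i j) =
      restart.runMeasure (gate 0) σ (cyl ρ t) * law (gate n) (delay n i 0) *
        σ.ext _ (Preorder.frestrictLe (t + 1 + wait n i + 1) (delayPath ρ t n i)) (dip n j) := by
  rw [← runMeasure_delayPath h i]
  exact runMeasure_cyl_inter (M := restart) (gate 0) σ (delayPath ρ t n i)
    (t + 1 + wait n i + 1) (dip n j)

theorem runMeasure_crashEvent {ρ : ℕ → restart.State} {t n : ℕ} (h : ρ t = gate n) (i j : ℕ) :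
    restart.runMeasure (gate 0) σ (crashEvent ρ t n i j) =
      restart.runMeasure (gate 0) σ (cyl ρ t) * law (gate n) (delay n i 0) *
        σ.ext _ (Preorder.frestrictLe (t + 1 + wait n i + 1) (delayPath ρ t n i)) (dip n j) *
          crashProb n j := by
  rw [← runMeasure_delayPath h i]
  have h1 := runMeasure_cyl_inter_inter (M := restart) (gate 0) σ (delayPath ρ t n i)
    (t + 1 + wait n i + 1) (s := dip n j) (notMem_controlled (by intro n h; cases h)) (crash n)
  exact h1.trans (congrArg _ (law_dip n j))

theorem exists_lt_map_eq {k : ℕ} {Mode : Type} [Finite Mode] (hk : Nat.card Mode ≤ k)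
    (f : ℕ → Mode) : ∃ i i', i < i' ∧ i' ≤ k ∧ f i = f i' := by
  have := Fintype.ofFinite Mode
  obtain ⟨a, b, hab, h⟩ := Fintype.exists_ne_map_eq_of_card_lt (fun i : Fin (k + 1) => f i)
    (by rw [Fintype.card_fin, ← Nat.card_eq_fintype_card]; omega)
  rcases lt_or_gt_of_ne hab with h1 | h1
  · exact ⟨a, b, h1, by omega, h⟩
  · exact ⟨b, a, h1, by omega, h.symm⟩

/-- A lower bound for the probability of a failure in the `n`-th gadget, for strategies with `K`
modes. -/
noncomputable def failureBound (K n : ℕ) : ENNReal :=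
  if K ≤ lev n then 2⁻¹ ^ (lev n * lev n) / ((lev n : ENNReal) + 1) * (K : ENNReal)⁻¹ else 0

/-- The pigeonhole argument, carried out after a fixed history `ρ`: the more than K levels of the
gadget are mapped to likely modes at their forks, and two levels with a common mode cannot both be
answered well. -/
theorem failureBound_mul_cyl_le {Mode : Type} [Finite Mode] {T : restart.Memory Mode}
    (hT : T.Implements σ) {ρ : ℕ → restart.State} {t n : ℕ} (h : ρ t = gate n) :
    failureBound (Nat.card Mode) n * restart.runMeasure (gate 0) σ (cyl ρ t) ≤
      restart.runMeasure (gate 0) σ (cyl ρ t ∩ failure n) := by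
  unfold failureBound
  split_ifs with hK
  swap
  · rw [zero_mul]; exact zero_le
  by_cases h0 : restart.runMeasure (gate 0) σ (cyl ρ t) = 0
  · rw [h0, mul_zero]; exact zero_le
  have ht : t ≤ timeBound n := by
    obtain ⟨ω, hω, hc⟩ := exists_run_mem_cyl h0
    exact time_le_of_gate hω ((hc t le_rfl).trans h)
  have hmode : ∀ i, ∃ m, i ≤ lev n → ∀ s', (Nat.card Mode : ENNReal)⁻¹ * T.succWeight m (fork n) s' ≤
      σ.ext _ (Preorder.frestrictLe (t + 1 + wait n i + 1) (delayPath ρ t n i)) s' := by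
    intro i
    by_cases hi : i ≤ lev n
    · have hc := delayPath_fork ρ t n i
      have hne : restart.runMeasure (gate 0) σ
          (cyl (delayPath ρ t n i) (t + 1 + wait n i + 1)) ≠ 0 := by
        rw [runMeasure_delayPath h]
        refine mul_ne_zero h0 (ne_of_gt (lt_of_lt_of_le ?_ (le_law_gate hi)))
        exact ENNReal.div_pos (pow_ne_zero _ (by simp)) (by finiteness)
      obtain ⟨m, hm⟩ := hT.exists_mode (gate 0) (ρ := delayPath ρ t n i) ⟨n, hc.symm⟩ hne
      refine ⟨m, fun _ s' => ?_⟩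
      have := hm s'
      rwa [hc] at this
    · exact ⟨T.init, fun h' => absurd h' hi⟩
  choose f hf using hmode
  obtain ⟨i, i', hii, hi', hfi⟩ := exists_lt_map_eq hK f
  have hi : i ≤ lev n := by omega
  set κ : ENNReal := (Nat.card Mode : ENNReal)⁻¹
  set c : ENNReal := 2⁻¹ ^ (lev n * lev n) / ((lev n : ENNReal) + 1) with hc
  set P := restart.runMeasure (gate 0) σ (cyl ρ t)
  -- For each choice `j` of the common mode, the level that `j` answers badly: a crash after the
  -- longer delay `i'` if `j < i'`, and otherwise an excessive loss after the shorter delay `i`.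
  let B : ℕ → Set (ℕ → restart.State) := fun j =>
    if j < i' then crashEvent ρ t n i' j else choiceEvent ρ t n i j
  have hBsub : ∀ j, B j ⊆ cyl ρ t ∩ failure n := by
    intro j
    simp only [B]
    split_ifs with hj
    · exact Set.subset_inter (Set.inter_subset_left.trans (choiceEvent_subset_cyl ..))
        (crashEvent_subset_failure ht hi')
    · exact Set.subset_inter (choiceEvent_subset_cyl ..)
        (choiceEvent_subset_failure ht (by omega))
  have hBmeas : ∀ j, MeasurableSet (B j) := by
    intro j
    simp only [B]
    split_ifs
    · exact measurableSet_crashEvent ..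
    · exact measurableSet_choiceEvent ..
  have hBmem : ∀ j ω, ω ∈ B j → ∃ l, ω ∈ choiceEvent ρ t n l j := by
    intro j ω hω
    simp only [B] at hω
    split_ifs at hω
    · exact ⟨_, hω.1⟩
    · exact ⟨_, hω⟩
  have hBdisj : ∀ j j', j ≠ j' → Disjoint (B j) (B j') := by
    intro j j' hjj
    rw [Set.disjoint_left]
    intro ω h1 h2
    obtain ⟨l, hl⟩ := hBmem j ω h1
    obtain ⟨l', hl'⟩ := hBmem j' ω h2
    exact hjj (eq_of_mem_choiceEvent hl hl').2
  have hchoice : ∀ l, l ≤ lev n → ∀ j,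
      P * law (gate n) (delay n l 0) * (κ * T.succWeight (f l) (fork n) (dip n j)) ≤
        restart.runMeasure (gate 0) σ (choiceEvent ρ t n l j) := by
    intro l hl j
    rw [runMeasure_choiceEvent h]
    exact mul_le_mul' le_rfl (hf l hl (dip n j))
  have hcrash : ∀ l, l ≤ lev n → ∀ j,
      P * law (gate n) (delay n l 0) * (κ * T.succWeight (f l) (fork n) (dip n j)) *
        crashProb n j ≤ restart.runMeasure (gate 0) σ (crashEvent ρ t n l j) := by
    intro l hl j
    rw [runMeasure_crashEvent h]
    exact mul_le_mul' (mul_le_mul' le_rfl (hf l hl (dip n j))) le_rfl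
  have hpow : ∀ {a b : ℕ}, a ≤ b → (2⁻¹ : ENNReal) ^ b ≤ 2⁻¹ ^ a := fun hab =>
    pow_le_pow_right_of_le_one' (by simp) hab
  have hB : ∀ j, P * (c * κ) * T.succWeight (f i) (fork n) (dip n j) ≤
      restart.runMeasure (gate 0) σ (B j) := by
    intro j
    simp only [B]
    split_ifs with hj
    · refine le_trans ?_ (hcrash i' hi' j)
      rw [← hfi]
      -- As j + 1 ≤ i', the exponents k(k-i') and k(j+1) add up to at most k².
      have h1 : c ≤ law (gate n) (delay n i' 0) * crashProb n j := by
        refine le_trans ?_ (mul_le_mul' (le_law_gate hi') le_rfl)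
        unfold crashProb
        rw [hc, div_eq_mul_inv, div_eq_mul_inv, mul_right_comm, ← pow_add, ← mul_add]
        exact mul_le_mul' (hpow (Nat.mul_le_mul_left _ (by omega))) le_rfl
      calc P * (c * κ) * T.succWeight (f i) (fork n) (dip n j)
          ≤ P * (law (gate n) (delay n i' 0) * crashProb n j * κ) *
            T.succWeight (f i) (fork n) (dip n j) := by gcongr
        _ = _ := by ring
    · refine le_trans ?_ (hchoice i hi j)
      have h1 : c ≤ law (gate n) (delay n i 0) := by
        refine le_trans ?_ (le_law_gate hi)
        exact ENNReal.div_le_div_right (hpow (Nat.mul_le_mul_left _ (Nat.sub_le _ _))) _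
      calc P * (c * κ) * T.succWeight (f i) (fork n) (dip n j)
          ≤ P * (law (gate n) (delay n i 0) * κ) *
            T.succWeight (f i) (fork n) (dip n j) := by gcongr
        _ = _ := by ring
  calc c * κ * P = ∑ j ∈ Finset.range (lev n + 1),
        P * (c * κ) * T.succWeight (f i) (fork n) (dip n j) := by
        rw [← Finset.mul_sum, sum_succWeight_dip, mul_one, mul_comm]
    _ ≤ ∑ j ∈ Finset.range (lev n + 1), restart.runMeasure (gate 0) σ (B j) :=
        Finset.sum_le_sum fun j _ => hB j
    _ = restart.runMeasure (gate 0) σ (⋃ j ∈ Finset.range (lev n + 1), B j) :=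
        (measure_biUnion_finset (fun j _ j' _ hjj => hBdisj j j' hjj) fun j _ => hBmeas j).symm
    _ ≤ _ := measure_mono (Set.iUnion₂_subset fun j _ => hBsub j)

end Restart

/-! ### From single gadgets to infinitely many failures. -/

namespace Restart
open St MDP

/-- If membership in `H` is determined when the `n`-th gadget is entered, then a failure in that
gadget has conditional probability at least `failureBound` given `H`. -/
theorem failureBound_mul_le {σ : restart.Strategy} {Mode : Type} [Finite Mode]
    {T : restart.Memory Mode} (hT : T.Implements σ) {n : ℕ} {H : Set (ℕ → restart.State)}
    (hH : ∀ ω ∈ restart.runs (gate 0), ∀ ω' ∈ restart.runs (gate 0), ∀ t, ω t = gate n →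
      ω' ∈ cyl ω t → ω ∈ H → ω' ∈ H) :
    failureBound (Nat.card Mode) n * restart.runMeasure (gate 0) σ H ≤
      restart.runMeasure (gate 0) σ (H ∩ failure n) := by
  -- The histories in `H` at the entry of the gadget. Their cylinders cover `H` almost surely, and
  -- are almost disjoint because a run passes the gate only once.
  let ι : Type := {x : Σ t, restart.Hist t // ∃ ω ∈ restart.runs (gate 0), ω ∈ H ∧
    ω x.1 = gate n ∧ Preorder.frestrictLe x.1 ω = x.2}
  have hr : ∀ x : ι, ∃ ω ∈ restart.runs (gate 0), ω ∈ H ∧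
    ω x.1.1 = gate n ∧ Preorder.frestrictLe x.1.1 ω = x.1.2 := fun x => x.2
  choose r hrun hrH hrg hrx using hr
  have hcover : ∀ᵐ ω ∂restart.runMeasure (gate 0) σ, ω ∈ H → ω ∈ ⋃ x : ι, cyl (r x) x.1.1 := by
    filter_upwards [ae_mem_runs (M := restart) (gate 0) σ] with ω hω hωH
    obtain ⟨t, -, ht⟩ := exists_run_eq_gate hω n
    let x : ι := ⟨⟨t, Preorder.frestrictLe t ω⟩, ω, hω, hωH, ht, rfl⟩
    exact Set.mem_iUnion.2 ⟨x, (frestrictLe_apply_eq_iff _ _).1 (hrx x).symm⟩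
  have hdisj : Pairwise (Function.onFun (AEDisjoint (restart.runMeasure (gate 0) σ))
      fun x : ι => cyl (r x) x.1.1 ∩ failure n) := by
    intro x y hxy
    have hnull : restart.runMeasure (gate 0) σ (restart.runs (gate 0))ᶜ = 0 :=
      ae_mem_runs (M := restart) (gate 0) σ
    refine measure_mono_null ?_ hnull
    rintro ω ⟨⟨hx, -⟩, hy, -⟩ hω
    have htx : ω x.1.1 = gate n := (hx _ le_rfl).trans (hrg x)
    have hty : ω y.1.1 = gate n := (hy _ le_rfl).trans (hrg y)
    have hxx := (frestrictLe_apply_eq_iff _ _).2 hx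
    have hyy := (frestrictLe_apply_eq_iff _ _).2 hy
    rw [hrx] at hxx hyy
    have ht := run_injective hω (htx.trans hty.symm)
    apply hxy
    obtain ⟨⟨t, h⟩, _⟩ := x
    obtain ⟨⟨u, k⟩, _⟩ := y
    obtain rfl : t = u := ht
    obtain rfl : h = k := hxx.symm.trans hyy
    rfl
  calc failureBound (Nat.card Mode) n * restart.runMeasure (gate 0) σ H
      ≤ failureBound (Nat.card Mode) n *
          ∑' x : ι, restart.runMeasure (gate 0) σ (cyl (r x) x.1.1) :=
        mul_le_mul' le_rfl ((measure_mono_ae hcover).trans (measure_iUnion_le _))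
    _ = ∑' x : ι, failureBound (Nat.card Mode) n *
          restart.runMeasure (gate 0) σ (cyl (r x) x.1.1) := ENNReal.tsum_mul_left.symm
    _ ≤ ∑' x : ι, restart.runMeasure (gate 0) σ (cyl (r x) x.1.1 ∩ failure n) :=
        ENNReal.tsum_le_tsum fun x => failureBound_mul_cyl_le hT (hrg x)
    _ = restart.runMeasure (gate 0) σ (⋃ x : ι, cyl (r x) x.1.1 ∩ failure n) :=
        (measure_iUnion₀ hdisj fun x =>
          ((measurableSet_cyl _ _).inter (measurableSet_failure n)).nullMeasurableSet).symm
    _ ≤ restart.runMeasure (gate 0) σ (H ∩ failure n) := by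
        refine measure_mono_ae ?_
        filter_upwards [ae_mem_runs (M := restart) (gate 0) σ] with ω hω hx
        obtain ⟨x, hx, hf⟩ := Set.mem_iUnion.1 hx
        exact ⟨hH (r x) (hrun x) ω hω _ (hrg x) hx (hrH x), hf⟩

theorem tsum_failureBound (K N : ℕ) : ∑' l, failureBound K (l + N) = ⊤ := by
  have h1 : ∑' n, failureBound K n = ⊤ := tsum_lev_ge_eq_top K (K : ENNReal)⁻¹ (by simp)
  rcases Nat.eq_zero_or_pos K with rfl | hK
  -- No memory has zero modes, but the identity still holds there since the inverse of 0 is `⊤`.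
  · refine ENNReal.tsum_eq_top_of_eq_top ⟨0, ?_⟩
    have : (2⁻¹ : ENNReal) ^ (lev (0 + N) * lev (0 + N)) / ((lev (0 + N) : ENNReal) + 1) ≠ 0 :=
      (ENNReal.div_pos (pow_ne_zero _ (by simp)) (by finiteness)).ne'
    simp only [failureBound, zero_le, if_true, Nat.cast_zero, ENNReal.inv_zero]
    exact ENNReal.mul_top this
  · rw [← Summable.sum_add_tsum_nat_add' (k := N) ENNReal.summable] at h1
    refine (ENNReal.add_eq_top.1 h1).resolve_left (ENNReal.sum_ne_top.2 fun n _ => ?_)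
    unfold failureBound
    split_ifs
    · have h2 : ((lev n : ENNReal) + 1) ≠ 0 := by positivity
      have h3 : (K : ENNReal) ≠ 0 := by positivity
      have h4 : (2⁻¹ : ENNReal) ^ (lev n * lev n) ≠ ⊤ := ENNReal.pow_ne_top (by simp)
      exact ENNReal.mul_ne_top (ENNReal.div_ne_top h4 h2) (ENNReal.inv_ne_top.2 h3)
    · exact ENNReal.zero_ne_top

/-- There is no failure in the gadgets `N, …, n - 1`. -/
def noFailure (N n : ℕ) : Set (ℕ → restart.State) := {ω | ∀ m, N ≤ m → m < n → ω ∉ failure m}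

theorem measurableSet_noFailure (N n : ℕ) : MeasurableSet (noFailure N n) := by
  have : noFailure N n = ⋂ m, ⋂ (_ : N ≤ m), ⋂ (_ : m < n), (failure m)ᶜ := by
    ext ω
    simp [noFailure]
  rw [this]
  exact .iInter fun m => .iInter fun _ => .iInter fun _ => (measurableSet_failure m).compl

/-- Failures in gadgets before `n` happen before the entry of gadget `n`, so the common prefix
decides them. -/
theorem noFailure_congr {N n t : ℕ} {ω ω' : ℕ → restart.State}
    (hω' : ω' ∈ restart.runs (gate 0)) (ht : ω t = gate n) (hc : ω' ∈ cyl ω t)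
    (h : ω ∈ noFailure N n) : ω' ∈ noFailure N n := by
  rintro m hN hm ⟨u, hu0, hug, hur⟩
  have ht' : ω' t = gate n := (hc t le_rfl).trans ht
  have hut : u < t := by
    refine (rank_run_strictMono hω').lt_iff_lt.1 ?_
    simp only [ht']
    exact rank_lt_of_gadget_lt (by omega)
  refine h m hN hm ⟨u, hu0, ?_⟩
  rw [← hc u hut.le]
  exact ⟨hug, hur⟩

/-- A conditional second Borel–Cantelli argument. First failures in different gadgets are disjoint
events, each of probability at least `failureBound` times that of no failure at all; as the bounds
sum to `⊤`, the latter probability vanishes. -/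
theorem ae_exists_failure {σ : restart.Strategy} (hσ : σ.IsFiniteMemory) (N : ℕ) :
    ∀ᵐ ω ∂restart.runMeasure (gate 0) σ, ∃ n ≥ N, ω ∈ failure n := by
  obtain ⟨Mode, _, T, hT⟩ := hσ
  set G : Set (ℕ → restart.State) := {ω | ¬ ∃ n ≥ N, ω ∈ failure n}
  change restart.runMeasure (gate 0) σ G = 0
  have hle : ∀ l, failureBound (Nat.card Mode) (l + N) * restart.runMeasure (gate 0) σ G ≤
      restart.runMeasure (gate 0) σ (noFailure N (l + N) ∩ failure (l + N)) := by
    intro l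
    refine le_trans (mul_le_mul' le_rfl (measure_mono ?_))
      (failureBound_mul_le hT fun ω _ ω' hω' t ht hc h => noFailure_congr hω' ht hc h)
    intro ω hω m hN _ hf
    exact hω ⟨m, hN, hf⟩
  have hdisj : Pairwise (Function.onFun (AEDisjoint (restart.runMeasure (gate 0) σ))
      fun l => noFailure N (l + N) ∩ failure (l + N)) := by
    have key : ∀ l l', l < l' → Disjoint (noFailure N (l + N) ∩ failure (l + N))
        (noFailure N (l' + N) ∩ failure (l' + N)) := fun l l' hll =>
      Set.disjoint_left.2 fun ω h h' => h'.1 (l + N) (by omega) (by omega) h.2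
    intro l l' hll
    rcases lt_or_gt_of_ne hll with h | h
    · exact (key l l' h).aedisjoint
    · exact (key l' l h).symm.aedisjoint
  have hsum := (ENNReal.tsum_le_tsum hle).trans (tsum_measure_le_measure_univ
    (fun l => ((measurableSet_noFailure N (l + N)).inter
      (measurableSet_failure (l + N))).nullMeasurableSet) hdisj)
  rw [ENNReal.tsum_mul_right, tsum_failureBound] at hsum
  by_contra h0
  rw [ENNReal.top_mul h0, top_le_iff] at hsum
  exact measure_ne_top (MDP.runMeasure restart _ σ) _ hsum

theorem runMeasure_of_isFiniteMemory {σ : restart.Strategy} (hσ : σ.IsFiniteMemory) :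
    restart.runMeasure (gate 0) σ (restart.meanPayoffLiminfNonneg (gate 0)) = 0 := by
  refine measure_mono_null ?_ (ae_all_iff.2 fun N => ae_exists_failure hσ N)
  intro ω hω hf
  exact notMem_meanPayoff hf hω

end Restart

theorem mainTheorem7 :
    ∃ (M : MDP) (s₀ : M.State),
      M.FinitelyBranching ∧ M.Acyclic ∧ M.TotalRewardImplicit s₀ ∧
      (∃ σ : M.Strategy, σ.IsDeterministic ∧
        M.runMeasure s₀ σ (M.meanPayoffLiminfNonneg s₀) = 1) ∧
      (∀ σ : M.Strategy, σ.IsFiniteMemory →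
        M.runMeasure s₀ σ (M.meanPayoffLiminfNonneg s₀) = 0) :=
  ⟨Restart.restart, Restart.St.gate 0, Restart.finitelyBranching, Restart.acyclic,
    Restart.totalRewardImplicit,
    ⟨Restart.delayStrategy, Restart.delayStrategy_isDeterministic,
      Restart.runMeasure_delayStrategy⟩,
    fun _ hσ => Restart.runMeasure_of_isFiniteMemory hσ⟩
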